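/- Write $\mathrm e(x)=\exp(2\pi i x)$, let $\|x\|$ denote the distance from $x\in\mathbb R$ to the nearest integer, and let $\tau_5(m)$ be the $5$-fold divisor function, i.e. the number of ordered $5$-tuples of positive integers with product $m$. For every integer $k\ge 1$ there are constants $C=C(k)>0$ and $A=A(k)>0$, depending only on $k$, such that the following holds. Let $N\ge 2$ be an integer and let $H=N^\theta$ with $0<\theta\le 1$. Let $\delta\in(0,1/2)$ and let $M$ be a real number with $1\le M\le \delta^{C}H$. Let $(b_m)_{m\ge1}$ be complex numbers with $|b_m|\le\tau_5(m)$ for each $m$, and let $$g(n)=\sum_{j=1}^k\alpha_j(n-N)^j,\qquad \alpha_1,\dots,\alpha_k\in\mathbb R .$$ If, for either $\psi(\ell)=1$ or $\psi(\ell)=\log \ell$, $$\Bigl|\sum_{\substack{\ell,m\ge1\\ M<m\le 2M\\ N<\ell m\le N+H}}\psi(\ell)\,b_m\,\mathrm e(g(\ell m))\Bigr|\ \ge\ \delta H(\log N)^{13},$$ then there exists a positive integer $q\le\delta^{-A}$ such that $$\|q\alpha_j\|\le \delta^{-A}\,\frac1{H^j}\qquad\text{for all }1\le j\le k .$$ 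-/

import Mathlib

namespace TypeI

/-- The additive character `e(x) = exp(2πix)`. -/
noncomputable def e (x : ℝ) : ℂ := Complex.exp (2 * Real.pi * Complex.I * x)

/-- The distance from `x` to the nearest integer. -/
noncomputable def distInt (x : ℝ) : ℝ := |x - round x|

/-- The `r`-fold divisor function: the number of ordered `r`-tuples of positive integers with
product `n` (for `n ≥ 1`). -/
def tau (r n : ℕ) : ℕ := (Nat.finMulAntidiag r n).card

/-- The polynomial `g(x) = ∑_{1 ≤ j ≤ k} α_j (x - N)^j`. -/
noncomputable def poly (k N : ℕ) (α : ℕ → ℝ) (x : ℝ) : ℝ :=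
  ∑ j ∈ Finset.Icc 1 k, α j * (x - N) ^ j

open Classical in
/-- The pairs `(ℓ, m)` of positive integers with `M < m ≤ 2M` and `N < ℓm ≤ N + H`; the bounding
box only makes the set visibly finite, see `mem_pairs`. -/
noncomputable def pairs (N : ℕ) (H M : ℝ) : Finset (ℕ × ℕ) :=
  (Finset.Icc 1 ⌊(N : ℝ) + H⌋₊ ×ˢ Finset.Icc 1 ⌊2 * M⌋₊).filter fun p =>
    (M < p.2 ∧ (p.2 : ℝ) ≤ 2 * M) ∧ ((N : ℝ) < p.1 * p.2 ∧ (p.1 * p.2 : ℝ) ≤ N + H)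

theorem mem_pairs (N : ℕ) (H M : ℝ) (ℓ m : ℕ) :
    (ℓ, m) ∈ pairs N H M ↔
      (M < m ∧ (m : ℝ) ≤ 2 * M) ∧ ((N : ℝ) < ℓ * m ∧ (ℓ * m : ℝ) ≤ N + H) := by
  simp only [pairs, Finset.mem_filter, Finset.mem_product, Finset.mem_Icc]
  refine ⟨fun h => h.2, fun h => ⟨?_, h⟩⟩
  obtain ⟨⟨_, h2⟩, h3, h4⟩ := h
  have h0 : 0 < ℓ * m := by
    have : (0 : ℝ) < ((ℓ * m : ℕ) : ℝ) := by
      push_cast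
      exact lt_of_le_of_lt (Nat.cast_nonneg N) h3
    exact_mod_cast this
  have hl : 0 < ℓ := Nat.pos_of_mul_pos_right h0
  have hm : 0 < m := Nat.pos_of_mul_pos_left h0
  refine ⟨⟨hl, Nat.le_floor (le_trans ?_ h4)⟩, hm, Nat.le_floor h2⟩
  exact_mod_cast Nat.le_mul_of_pos_right ℓ hm

end TypeI

/-! Put `B = δ⁻¹ ≥ 2`; every loss is recorded as a power of `B`. Group the sum by `m`. Partial
summation removes `ψ` and leaves tails of `∑ e(g(ℓm))` over multiples of `m`. Cauchy–Schwarz and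
`τ_5² ≤ τ_25` prevent few moduli from carrying the sum, so a proportion at least `B^(-49)` of the `m
≤ X = ⌊2M⌋` have a tail of size at least `B^(-24) H / m` (`many_good_moduli`). Of the 13 logarithms
one pays for `ψ` and twelve for the square root of the second moment of `τ_5`.

If the tail for `m` starts at `N + r`, then `g(N + r + im)` is a polynomial in `i` whose coefficient
of degree `j` is `m^j α_j` plus integer combinations of higher `α`'s. The inverse Weyl inequality
(`weyl_inverse`) makes these coefficients nearly rational, and pigeonholing gives one denominator
for many `m`.

The system is solved from the top degree down (`triangular_recurrence`): once the higher `α`'s are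
approximated, their contribution can be subtracted, leaving `‖m^j Q α_j‖ ≤ B^O(1) (X/H)^j` for many
`m ≤ X`. Then `monomial_recurrence` gains a factor `X^(-j)`, which is the precision `H^(-j)`. It
needs `X/H` to be small, which is the role of `M ≤ δ^C H`.

The same elimination proves `weyl_inverse` by induction on the degree: differencing gives the
coefficients of degree at least two, and `linear_coefficient` supplies the remaining one. The
recurrence lemmas also use differencing, applied to the indicator of a dense set, to reduce to
degree one (`linear_recurrence`). -/

namespace TypeI

open Finset

/-! ### Distance to the nearest integer -/

section DistInt

theorem distInt_le (x : ℝ) (n : ℤ) : distInt x ≤ |x - n| := round_le x n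

theorem distInt_nonneg (x : ℝ) : 0 ≤ distInt x := abs_nonneg _

theorem distInt_le_half (x : ℝ) : distInt x ≤ 1 / 2 := abs_sub_round x

theorem distInt_zero : distInt 0 = 0 := by simp [distInt]

theorem distInt_add (x y : ℝ) : distInt (x + y) ≤ distInt x + distInt y := by
  refine (distInt_le (x + y) (round x + round y)).trans ?_
  push_cast
  rw [show x + y - (round x + round y : ℝ) = (x - round x) + (y - round y) by ring]
  exact abs_add_le _ _

theorem distInt_int_mul (n : ℤ) (x : ℝ) : distInt (n * x) ≤ |(n : ℝ)| * distInt x := by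
  refine (distInt_le _ (n * round x)).trans ?_
  push_cast
  rw [← mul_sub, abs_mul, distInt]

theorem distInt_nat_mul (n : ℕ) (x : ℝ) : distInt (n * x) ≤ n * distInt x := by
  simpa using distInt_int_mul n x

theorem distInt_neg_le (x : ℝ) : distInt (-x) ≤ distInt x := by
  simpa using distInt_int_mul (-1) x

theorem distInt_sub (x y : ℝ) : distInt (x - y) ≤ distInt x + distInt y := by
  rw [sub_eq_add_neg]
  exact (distInt_add _ _).trans (by gcongr; exact distInt_neg_le y)

theorem distInt_sum {ι : Type*} (s : Finset ι) (f : ι → ℝ) :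
    distInt (∑ i ∈ s, f i) ≤ ∑ i ∈ s, distInt (f i) := by
  classical
  induction s using Finset.induction_on with
  | empty => simp [distInt_zero]
  | insert a s ha ih =>
    rw [sum_insert ha, sum_insert ha]
    exact (distInt_add _ _).trans (by gcongr)

/-- A nonzero nearest integer is at distance at least `1 - |x| ≥ 1/2` from `x`; this covers the
endpoint `1/2`, which rounds to `1`. -/
theorem abs_le_distInt {x : ℝ} (hx : |x| ≤ 1 / 2) : |x| ≤ distInt x := by
  by_cases h : round x = 0
  · simp [distInt, h]
  · have h1 : (1 : ℝ) ≤ |(round x : ℝ)| := by exact_mod_cast Int.one_le_abs h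
    have h2 : |(round x : ℝ)| ≤ |x| + |x - round x| := by
      have := abs_sub_abs_le_abs_sub (round x : ℝ) x
      rw [abs_sub_comm] at this
      linarith
    unfold distInt
    linarith

/-- Multiplying a number by its distance to the nearest integer instead of by the number itself
does not change the distance of a multiple to the nearest integer. -/
theorem distInt_nat_mul_distInt (h : ℕ) (x : ℝ) : distInt (h * distInt x) ≤ distInt (h * x) := by
  have key : distInt (h * (x - round x)) ≤ distInt (h * x) := by
    refine (distInt_le _ (round (h * x) - h * round x)).trans ?_
    push_cast
    rw [distInt]
    apply le_of_eq
    congr 1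
    ring
  rcases abs_choice (x - round x) with hc | hc
  · rw [show distInt x = x - round x from hc]; exact key
  · rw [show distInt x = -(x - round x) from hc, mul_neg]
    exact (distInt_neg_le _).trans key

end DistInt

/-! ### The additive character and geometric sums -/

section Character

theorem e_eq (x : ℝ) : e x = Complex.exp (Complex.I * ((2 * Real.pi * x : ℝ) : ℂ)) := by
  unfold e
  congr 1
  push_cast
  ring

theorem norm_e (x : ℝ) : ‖e x‖ = 1 := by
  rw [e_eq]; exact Complex.norm_exp_I_mul_ofReal _

theorem e_add (x y : ℝ) : e (x + y) = e x * e y := by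
  unfold e
  rw [← Complex.exp_add]
  congr 1
  push_cast
  ring

theorem e_int (n : ℤ) : e n = 1 := by
  unfold e
  rw [Complex.exp_eq_one_iff]
  exact ⟨n, by push_cast; ring⟩

theorem e_neg (x : ℝ) : e (-x) = (starRingEnd ℂ) (e x) := by
  unfold e
  rw [← Complex.exp_conj]
  congr 1
  simp [Complex.conj_ofNat]

theorem e_sub (x y : ℝ) : e (x - y) = e x * (starRingEnd ℂ) (e y) := by
  rw [sub_eq_add_neg, e_add, e_neg]

theorem e_sub_round (x : ℝ) : e (x - round x) = e x := by
  have h := e_add (x - round x) (round x)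
  rw [e_int, mul_one, sub_add_cancel] at h
  exact h.symm

theorem e_nat_mul (n : ℕ) (x : ℝ) : e (n * x) = e x ^ n := by
  unfold e
  rw [← Complex.exp_nat_mul]
  congr 1
  push_cast
  ring

theorem norm_e_sub_one_le (x : ℝ) : ‖e x - 1‖ ≤ 8 * distInt x := by
  rw [← e_sub_round, e_eq]
  refine (Real.norm_exp_I_mul_ofReal_sub_one_le).trans ?_
  rw [Real.norm_eq_abs, abs_mul, abs_of_pos (by positivity : (0 : ℝ) < 2 * Real.pi), distInt]
  have := Real.pi_lt_four
  gcongr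
  linarith

theorem norm_e_sub_e_le (x y : ℝ) : ‖e x - e y‖ ≤ 8 * distInt (x - y) := by
  have h : e x - e y = e y * (e (x - y) - 1) := by
    rw [mul_sub, ← e_add, mul_one]
    congr 2
    ring
  rw [h, norm_mul, norm_e, one_mul]
  exact norm_e_sub_one_le _

/-- The norm is `2 |sin πy|` with `|y| ≤ 1/2`, and Jordan's inequality bounds the sine below by
`2|y|`. -/
theorem distInt_le_norm_e_sub_one (x : ℝ) : 4 * distInt x ≤ ‖e x - 1‖ := by
  rw [← e_sub_round, e_eq, Complex.norm_exp_I_mul_ofReal_sub_one]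
  set y := x - round x with hy
  have hy2 : |y| ≤ 1 / 2 := abs_sub_round x
  have h := Real.mul_abs_le_abs_sin (x := 2 * Real.pi * y / 2) (by
    rw [show 2 * Real.pi * y / 2 = Real.pi * y by ring, abs_mul, abs_of_pos Real.pi_pos]
    nlinarith [Real.pi_pos])
  rw [Real.norm_eq_abs, abs_mul, abs_of_pos (two_pos : (0 : ℝ) < 2)]
  rw [show 2 * Real.pi * y / 2 = Real.pi * y by ring, abs_mul, abs_of_pos Real.pi_pos] at h
  rw [show 2 * Real.pi * y / 2 = Real.pi * y by ring]
  have h3 : 2 / Real.pi * (Real.pi * |y|) = 2 * |y| := by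
    field_simp
  rw [h3] at h
  have : distInt x = |y| := rfl
  rw [this]
  linarith

theorem norm_geom_sum_mul_distInt_le (T : ℕ) (β : ℝ) :
    ‖∑ t ∈ range T, e (t * β)‖ * distInt β ≤ 1 := by
  have h1 : (∑ t ∈ range T, e (t * β)) * (e β - 1) = e (T * β) - 1 := by
    simp_rw [e_nat_mul]
    exact geom_sum_mul _ _
  have h2 : ‖∑ t ∈ range T, e (t * β)‖ * ‖e β - 1‖ ≤ 2 := by
    rw [← norm_mul, h1]
    refine (norm_sub_le _ _).trans ?_
    rw [norm_e, norm_one]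
    norm_num
  have h3 := mul_le_mul_of_nonneg_left (distInt_le_norm_e_sub_one β)
    (norm_nonneg (∑ t ∈ range T, e (t * β)))
  linarith

end Character

/-! ### Pigeonhole arguments and recurrence in degree one -/

section Pigeonhole

/-- A function with values in `[1, Y]` has a large fibre. -/
theorem exists_large_fiber {ι : Type*} (T : Finset ι) (f : ι → ℕ) (Y : ℝ) (hY : 1 ≤ Y)
    (hf : ∀ x ∈ T, 1 ≤ f x ∧ (f x : ℝ) ≤ Y) :
    ∃ q : ℕ, 1 ≤ q ∧ (q : ℝ) ≤ Y ∧ (T.card : ℝ) ≤ Y * (T.filter fun x => f x = q).card := by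
  have hY0 : 0 < Y := by linarith
  have hmaps : ∀ x ∈ T, f x ∈ Icc 1 ⌊Y⌋₊ := fun x hx =>
    mem_Icc.2 ⟨(hf x hx).1, Nat.le_floor (hf x hx).2⟩
  have hne : (Icc 1 ⌊Y⌋₊).Nonempty := ⟨1, mem_Icc.2 ⟨le_rfl, Nat.le_floor (by simpa using hY)⟩⟩
  obtain ⟨q, hq, h⟩ := exists_le_card_fiber_of_nsmul_le_card_of_maps_to (M := ℝ) (s := T)
    (t := Icc 1 ⌊Y⌋₊) (f := f) (b := T.card / Y) hmaps hne (by
      rw [Nat.card_Icc, nsmul_eq_mul, Nat.add_sub_cancel]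
      calc (⌊Y⌋₊ : ℝ) * (T.card / Y) ≤ Y * (T.card / Y) := by
            gcongr; exact Nat.floor_le hY0.le
        _ = T.card := by field_simp)
  rw [mem_Icc] at hq
  refine ⟨q, hq.1, (Nat.cast_le.2 hq.2).trans (Nat.floor_le hY0.le), ?_⟩
  rw [div_le_iff₀ hY0] at h
  linarith

/-- If an average of numbers in `[0, U]` is large then many of them are large. -/
theorem card_large_terms {ι : Type*} (T : Finset ι) (a : ι → ℝ) (U c n : ℝ)
    (hc : 0 ≤ c) (ha : ∀ x ∈ T, a x ≤ U) (hT : (T.card : ℝ) ≤ n)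
    (hsum : 2 * c * n ≤ ∑ x ∈ T, a x) :
    c * n ≤ U * (T.filter fun x => c ≤ a x).card := by
  have h : ∑ x ∈ T, a x ≤ U * (T.filter fun x => c ≤ a x).card + c * n := by
    rw [← sum_filter_add_sum_filter_not T (fun x => c ≤ a x)]
    gcongr
    · refine (sum_le_card_nsmul _ _ U fun x hx => ha x (mem_filter.1 hx).1).trans ?_
      rw [nsmul_eq_mul, mul_comm]
    · refine (sum_le_card_nsmul _ _ c fun x hx => (not_le.1 (mem_filter.1 hx).2).le).trans ?_
      rw [nsmul_eq_mul, mul_comm]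
      gcongr
      exact (Nat.cast_le.2 (card_filter_le _ _)).trans hT
  linarith

/-- A dense subset of `[1, X]` has two elements at a distance `d < w` comparable to `w`. -/
theorem exists_pair_in_window (B : ℝ) (hB : 1 ≤ B) (X w : ℕ) (hw : w ≤ X) (hwB : 2 * B < w)
    (T : Finset ℕ) (hT : T ⊆ Icc 1 X) (hcard : (X : ℝ) ≤ B * T.card) :
    ∃ x ∈ T, ∃ d : ℕ, x + d ∈ T ∧ 1 ≤ d ∧ d < w ∧ (w : ℝ) ≤ 4 * B * d := by
  have hw0 : (0 : ℝ) < w := by linarith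
  have hwn : 0 < w := by exact_mod_cast hw0
  -- Cut into blocks of length `w`, of which there are at most `2X/w`. The least and greatest
  -- elements of a well-filled block form the pair.
  obtain ⟨i, hi, h⟩ := exists_le_card_fiber_of_nsmul_le_card_of_maps_to (M := ℝ) (s := T)
    (t := range (X / w + 1)) (f := fun x => x / w) (b := T.card * w / (2 * X))
    (fun x hx => mem_range.2 (Nat.lt_succ_of_le
      (Nat.div_le_div_right (mem_Icc.1 (hT hx)).2))) ⟨0, by simp⟩ (by
      rw [card_range, nsmul_eq_mul]
      have hX0 : (0 : ℝ) < X := hw0.trans_le (by exact_mod_cast hw)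
      have h1 : ((X / w + 1 : ℕ) : ℝ) * w ≤ 2 * X := by
        have : (X / w + 1) * w ≤ 2 * X := by
          have := Nat.div_mul_le_self X w
          nlinarith
        exact_mod_cast this
      calc ((X / w + 1 : ℕ) : ℝ) * (T.card * w / (2 * X))
          = (((X / w + 1 : ℕ) : ℝ) * w) * (T.card / (2 * X)) := by ring
        _ ≤ (2 * X) * (T.card / (2 * X)) := by gcongr
        _ = T.card := by field_simp)
  set S := T.filter fun x => x / w = i with hS
  have hX0 : (0 : ℝ) < X := hw0.trans_le (by exact_mod_cast hw)
  rw [div_le_iff₀ (by positivity)] at h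
  have h2 : (w : ℝ) ≤ 2 * B * S.card := by
    have h3 : (X : ℝ) * w ≤ X * (2 * B * S.card) := by
      calc (X : ℝ) * w ≤ B * T.card * w := by gcongr
        _ = B * (T.card * w) := by ring
        _ ≤ B * (S.card * (2 * X)) := by gcongr
        _ = X * (2 * B * S.card) := by ring
    exact le_of_mul_le_mul_left h3 hX0
  have hS1 : 1 < S.card := by
    by_contra hcon
    have : (S.card : ℝ) ≤ 1 := by exact_mod_cast not_lt.1 hcon
    nlinarith
  have hne : S.Nonempty := card_pos.1 (by omega)
  have hmin := S.min'_mem hne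
  have hmax := S.max'_mem hne
  have hle : S.min' hne ≤ S.max' hne := S.min'_le _ hmax
  have hsub : S ⊆ Icc (S.min' hne) (S.max' hne) := fun x hx =>
    mem_Icc.2 ⟨S.min'_le x hx, S.le_max' x hx⟩
  have hc := card_le_card hsub
  rw [Nat.card_Icc] at hc
  have hmin2 := (mem_filter.1 hmin).2
  have hmax2 := (mem_filter.1 hmax).2
  refine ⟨_, (mem_filter.1 hmin).1, S.max' hne - S.min' hne, ?_, by omega, ?_, ?_⟩
  · rw [Nat.add_sub_cancel' hle]
    exact (mem_filter.1 hmax).1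
  · have a1 := Nat.div_mul_le_self (S.min' hne) w
    have a2 := Nat.lt_div_mul_add (a := S.max' hne) hwn
    rw [hmin2] at a1
    rw [hmax2] at a2
    omega
  · have : (S.card : ℝ) ≤ 2 * ((S.max' hne - S.min' hne : ℕ) : ℝ) := by
      exact_mod_cast (by omega : S.card ≤ 2 * (S.max' hne - S.min' hne))
    nlinarith

/-- If `‖hβ‖` is small for many `h ≤ X`, then `β` is close to a rational number with small
denominator. -/
theorem linear_recurrence (B : ℝ) (hB : 2 ≤ B) (X : ℕ) (hX : 1 ≤ X) (T : Finset ℕ)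
    (hT : T ⊆ Icc 1 X) (hcard : (X : ℝ) ≤ B * T.card) (ε β : ℝ) (hε : B ^ 10 * ε ≤ 1)
    (h : ∀ x ∈ T, distInt (x * β) ≤ ε) :
    ∃ q : ℕ, 1 ≤ q ∧ (q : ℝ) ≤ B ^ 10 ∧ X * distInt (q * β) ≤ B ^ 10 * ε := by
  have hB1 : 1 ≤ B := by linarith
  have hX0 : (1 : ℝ) ≤ X := by exact_mod_cast hX
  have hTne : T.Nonempty := by
    rw [nonempty_iff_ne_empty]
    rintro rfl
    simp at hcard
    omega
  have hε0 : 0 ≤ ε := by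
    obtain ⟨x, hx⟩ := hTne
    exact (distInt_nonneg _).trans (h x hx)
  by_cases hXB : (X : ℝ) ≤ B ^ 3
  · obtain ⟨x, hx⟩ := hTne
    have hx1 := mem_Icc.1 (hT hx)
    have hp : B ^ 3 ≤ B ^ 10 := pow_le_pow_right₀ hB1 (by norm_num)
    refine ⟨x, hx1.1, ((Nat.cast_le.2 hx1.2).trans hXB).trans hp, ?_⟩
    exact mul_le_mul (hXB.trans hp) (h x hx) (distInt_nonneg _) (by positivity)
  push Not at hXB
  have hB23 : 2 * B + 1 ≤ B ^ 3 := by nlinarith [sq_nonneg B]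
  -- The shortest admissible window gives a denominator `q ≤ 2B`. So far `‖qβ‖` is only known to be
  -- at most `2ε`, without the gain of `X`.
  obtain ⟨x, hx, q, hxq, hq1, hqw, -⟩ := exists_pair_in_window B hB1 X (⌊2 * B⌋₊ + 1) (by
      have h1 : ((⌊2 * B⌋₊ + 1 : ℕ) : ℝ) ≤ X := by
        push_cast
        have := Nat.floor_le (by positivity : 0 ≤ 2 * B)
        linarith
      exact_mod_cast h1) (by push_cast; exact Nat.lt_floor_add_one _) T hT hcard
  have hqB : (q : ℝ) ≤ 2 * B :=
    (Nat.cast_le.2 (Nat.lt_succ_iff.1 hqw)).trans (Nat.floor_le (by positivity))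
  have hqB3 : (q : ℝ) ≤ B ^ 3 := by linarith
  set κ := distInt (q * β) with hκ
  have hκ0 : 0 ≤ κ := distInt_nonneg _
  have hκε : κ ≤ 2 * ε := by
    have : (q : ℝ) * β = ((x + q : ℕ) : ℝ) * β - x * β := by push_cast; ring
    rw [hκ, this]
    refine (distInt_sub _ _).trans ?_
    have := h x hx
    have := h _ hxq
    linarith
  refine ⟨q, hq1, hqB3.trans (pow_le_pow_right₀ hB1 (by norm_num)), ?_⟩
  rcases hκ0.eq_or_lt with h0 | hκpos
  · rw [← hκ, ← h0, mul_zero]; positivity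
  have hTκ : ∀ y ∈ T, distInt (y * κ) ≤ B ^ 3 * ε := by
    intro y hy
    refine (distInt_nat_mul_distInt y _).trans ?_
    rw [show (y : ℝ) * (q * β) = q * (y * β) by ring]
    refine (distInt_nat_mul _ _).trans ?_
    exact mul_le_mul hqB3 (h y hy) (distInt_nonneg _) (by positivity)
  -- In a window of length at most `1/(2κ)` the difference `d` satisfies `dκ ≤ 1/2`, so `dκ` equals
  -- its distance to the nearest integer. Smallness of that distance, with `d` comparable to `w`,
  -- bounds `wκ`.
  set w := min X ⌊1 / (2 * κ)⌋₊ with hw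
  have hB7 : B ^ 7 * (B ^ 3 * κ) ≤ 2 := by nlinarith [pow_pos (by linarith : (0 : ℝ) < B) 10]
  have hB7' : (128 : ℝ) ≤ B ^ 7 := by
    calc (128 : ℝ) = 2 ^ 7 := by norm_num
      _ ≤ B ^ 7 := by gcongr
  have hBκ : 4 * (B ^ 3 * κ) ≤ 1 := by
    have : 0 ≤ B ^ 3 * κ := by positivity
    nlinarith
  have hκ8 : κ ≤ 1 / 4 := by
    have : 1 ≤ B ^ 3 := one_le_pow₀ hB1
    nlinarith
  have hfl : B ^ 3 - 1 < (⌊1 / (2 * κ)⌋₊ : ℝ) := by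
    have h1 : B ^ 3 ≤ 1 / (2 * κ) := by
      rw [le_div_iff₀ (by positivity)]
      linarith
    have := Nat.lt_floor_add_one (1 / (2 * κ))
    linarith
  obtain ⟨y, hy, d, hyd, hd1, hdw, hwd⟩ := exists_pair_in_window B hB1 X w (min_le_left _ _) (by
    rw [hw, Nat.cast_min]
    apply lt_min <;> linarith) T hT hcard
  have hdκ : (d : ℝ) * κ ≤ 1 / 2 := by
    have h1 : (d : ℝ) ≤ 1 / (2 * κ) :=
      (Nat.cast_le.2 (hdw.le.trans (min_le_right _ _))).trans (Nat.floor_le (by positivity))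
    rw [le_div_iff₀ (by positivity)] at h1
    linarith
  have hdκ2 : (d : ℝ) * κ ≤ 2 * (B ^ 3 * ε) := by
    have h1 := abs_le_distInt (x := d * κ) (by rwa [abs_of_nonneg (by positivity)])
    rw [abs_of_nonneg (by positivity)] at h1
    refine h1.trans ?_
    have : (d : ℝ) * κ = ((y + d : ℕ) : ℝ) * κ - y * κ := by push_cast; ring
    rw [this]
    refine (distInt_sub _ _).trans ?_
    have := hTκ y hy
    have := hTκ _ hyd
    linarith
  have hwκ : (w : ℝ) * κ ≤ B ^ 7 * ε := by
    calc (w : ℝ) * κ ≤ 4 * B * d * κ := by gcongr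
      _ = 4 * B * (d * κ) := by ring
      _ ≤ 4 * B * (2 * (B ^ 3 * ε)) := by gcongr
      _ = 2 ^ 3 * (B ^ 4 * ε) := by ring
      _ ≤ B ^ 3 * (B ^ 4 * ε) := by gcongr
      _ = B ^ 7 * ε := by ring
  have hB3 : (8 : ℝ) ≤ B ^ 3 := by
    calc (8 : ℝ) = 2 ^ 3 := by norm_num
      _ ≤ B ^ 3 := by gcongr
  rcases min_choice X ⌊1 / (2 * κ)⌋₊ with hm | hm
  · rw [hw, hm] at hwκ
    refine hwκ.trans ?_
    gcongr
    norm_num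
  -- Here `wκ > 1/2 - κ ≥ 1/4`, whereas `B^7 ε ≤ B^(-3) ≤ 1/8`.
  · exfalso
    rw [hw, hm] at hwκ
    have h1 := Nat.lt_floor_add_one (1 / (2 * κ))
    rw [div_lt_iff₀ (by positivity)] at h1
    have h2 : B ^ 7 * ε * B ^ 3 ≤ 1 := by linarith [show B ^ 7 * ε * B ^ 3 = B ^ 10 * ε by ring]
    have h3 : 0 ≤ B ^ 7 * ε := by positivity
    nlinarith

end Pigeonhole

/-! ### Polynomial phases under substitution and differencing -/

section Phase

/-- The polynomial with coefficients `β 0, …, β (K - 1)`. -/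
noncomputable def phase (K : ℕ) (β : ℕ → ℝ) (x : ℝ) : ℝ := ∑ j ∈ range K, β j * x ^ j

/-- The coefficients of `phase K β (u * x + v)` as a polynomial in `x`. -/
noncomputable def shiftCoeff (K : ℕ) (u v : ℝ) (β : ℕ → ℝ) (i : ℕ) : ℝ :=
  ∑ j ∈ Ico i K, j.choose i * u ^ i * v ^ (j - i) * β j

/-- The coefficients of `phase K β (x + h) - phase K β x` as a polynomial in `x`. -/
noncomputable def diffCoeff (K : ℕ) (h : ℝ) (β : ℕ → ℝ) (i : ℕ) : ℝ :=
  ∑ j ∈ Ico (i + 1) K, j.choose i * h ^ (j - i) * β j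

theorem phase_comp (K : ℕ) (β : ℕ → ℝ) (u v x : ℝ) :
    phase K β (u * x + v) = phase K (shiftCoeff K u v β) x := by
  unfold phase shiftCoeff
  simp_rw [add_pow, mul_sum, sum_mul]
  rw [sum_comm' (t' := range K) (s' := fun i => Ico i K) (by
    intro a b
    simp only [mem_range, mem_Ico]
    omega)]
  refine sum_congr rfl fun i _ => sum_congr rfl fun j _ => ?_
  rw [mul_pow]
  ring

theorem phase_diff (K : ℕ) (β : ℕ → ℝ) (x h : ℝ) :
    phase (K + 1) β (x + h) - phase (K + 1) β x = phase K (diffCoeff (K + 1) h β) x := by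
  have h1 := phase_comp (K + 1) β 1 h x
  rw [one_mul] at h1
  rw [h1]
  unfold phase
  rw [← sum_sub_distrib, sum_range_succ]
  have h2 : ∀ i ∈ range (K + 1), shiftCoeff (K + 1) 1 h β i * x ^ i - β i * x ^ i
      = diffCoeff (K + 1) h β i * x ^ i := by
    intro i hi
    rw [← sub_mul]
    congr 1
    unfold shiftCoeff diffCoeff
    rw [sum_eq_sum_Ico_succ_bot (mem_range.1 hi)]
    simp
  rw [sum_congr rfl fun i hi => h2 i (mem_range.2 (by have := mem_range.1 hi; omega)),
    h2 K (self_mem_range_succ K)]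
  simp [diffCoeff]

end Phase

/-! ### Van der Corput differencing -/

section VanDerCorput

/-- Off-diagonal products are grouped by the difference `h` of their indices, those for `h` and `-h`
being conjugate. In the induction, the new index `L` adds exactly one product to each correlation.
-/
theorem norm_sq_sum_eq (f : ℕ → ℂ) (L : ℕ) :
    ‖∑ n ∈ range L, f n‖ ^ 2 = ∑ n ∈ range L, ‖f n‖ ^ 2 +
      2 * (∑ h ∈ Ico 1 L, ∑ n ∈ range (L - h), f (n + h) * (starRingEnd ℂ) (f n)).re := by
  induction L with
  | zero => simp
  | succ L ih =>
    have h1 : ∑ h ∈ Ico 1 (L + 1), ∑ n ∈ range (L + 1 - h), f (n + h) * (starRingEnd ℂ) (f n)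
        = (∑ h ∈ Ico 1 L, ∑ n ∈ range (L - h), f (n + h) * (starRingEnd ℂ) (f n))
          + f L * (starRingEnd ℂ) (∑ n ∈ range L, f n) := by
      have h2 : ∀ h ∈ Ico 1 (L + 1), ∑ n ∈ range (L + 1 - h), f (n + h) * (starRingEnd ℂ) (f n)
          = (∑ n ∈ range (L - h), f (n + h) * (starRingEnd ℂ) (f n))
            + f L * (starRingEnd ℂ) (f (L - h)) := by
        intro h hh
        rw [mem_Ico] at hh
        rw [show L + 1 - h = (L - h) + 1 by omega, sum_range_succ]
        rw [show L - h + h = L by omega]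
      rw [sum_congr rfl h2, sum_add_distrib, ← mul_sum]
      congr 1
      · rcases Nat.eq_zero_or_pos L with rfl | hL
        · simp
        · rw [sum_Ico_succ_top (by omega)]
          simp
      · rw [map_sum, sum_Ico_eq_sum_range, ← sum_range_reflect]
        congr 1
        refine sum_congr (by simp) fun i hi => ?_
        congr 2
        have := mem_range.1 hi
        omega
    rw [h1, sum_range_succ, sum_range_succ, ← Complex.normSq_eq_norm_sq, Complex.normSq_add,
      Complex.normSq_eq_norm_sq, Complex.normSq_eq_norm_sq, ih, Complex.add_re]
    have h3 : ((∑ n ∈ range L, f n) * (starRingEnd ℂ) (f L)).re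
        = (f L * (starRingEnd ℂ) (∑ n ∈ range L, f n)).re := by
      simp only [Complex.mul_re, Complex.conj_re, Complex.conj_im]
      ring
    rw [h3]
    ring

theorem norm_sq_sum_le (f : ℕ → ℂ) (L : ℕ) :
    ‖∑ n ∈ range L, f n‖ ^ 2 ≤ ∑ n ∈ range L, ‖f n‖ ^ 2 +
      2 * ∑ h ∈ Ico 1 L, ‖∑ n ∈ range (L - h), f (n + h) * (starRingEnd ℂ) (f n)‖ := by
  rw [norm_sq_sum_eq]
  gcongr
  exact (Complex.re_le_norm _).trans (norm_sum_le _ _)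

/-- A large sum of unimodular numbers has many large correlations. -/
theorem many_large_correlations (B : ℝ) (hB : 2 ≤ B) (L : ℕ) (hL : 2 * B ^ 2 ≤ L) (f : ℕ → ℂ)
    (hf : ∀ n, ‖f n‖ ≤ 1) (hsum : (L : ℝ) ≤ B * ‖∑ n ∈ range L, f n‖) :
    (L : ℝ) ≤ B ^ 5 * ((Ico 1 L).filter fun h =>
      (L : ℝ) ≤ B ^ 5 * ‖∑ n ∈ range (L - h), f (n + h) * (starRingEnd ℂ) (f n)‖).card := by
  have hB0 : 0 < B := by linarith
  have hL0 : (0 : ℝ) < L := lt_of_lt_of_le (by positivity) hL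
  have h1 := norm_sq_sum_le f L
  have h2 : ∑ n ∈ range L, ‖f n‖ ^ 2 ≤ L := by
    refine (sum_le_card_nsmul _ _ 1 fun n _ => ?_).trans (by simp)
    exact pow_le_one₀ (norm_nonneg _) (hf n)
  have h3 : (L : ℝ) ^ 2 ≤ B ^ 2 * ‖∑ n ∈ range L, f n‖ ^ 2 := by
    rw [← mul_pow]; gcongr
  have h4 : (L : ℝ) ^ 2 ≤ B ^ 2 * L + 2 * B ^ 2 *
      ∑ h ∈ Ico 1 L, ‖∑ n ∈ range (L - h), f (n + h) * (starRingEnd ℂ) (f n)‖ := by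
    nlinarith [pow_pos hB0 2]
  have h5 : (8 : ℝ) ≤ B ^ 3 := by
    calc (8 : ℝ) = 2 ^ 3 := by norm_num
      _ ≤ B ^ 3 := by gcongr
  have h6 : 8 * B ^ 2 ≤ B ^ 5 := by
    calc 8 * B ^ 2 ≤ B ^ 3 * B ^ 2 := by gcongr
      _ = B ^ 5 := by ring
  -- As `L ≥ 2B²`, the diagonal is at most half of `L²`, so the correlations sum to at least
  -- `L²/(4B²)`. The inequality `8B² ≤ B^5` then gives the average required here.
  have h7 := card_large_terms (Ico 1 L)
    (fun h => ‖∑ n ∈ range (L - h), f (n + h) * (starRingEnd ℂ) (f n)‖) L (L / B ^ 5) L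
    (by positivity) (fun h _ => by
      refine (norm_sum_le _ _).trans ((sum_le_card_nsmul _ _ 1 fun n _ => ?_).trans ?_)
      · rw [norm_mul, RCLike.norm_conj]
        exact mul_le_one₀ (hf _) (norm_nonneg _) (hf _)
      · simp) (by simp) (by
      have h8 : 2 * (L / B ^ 5) * L = 2 * L ^ 2 / B ^ 5 := by ring
      rw [h8, div_le_iff₀ (by positivity)]
      have h9 : (L : ℝ) ^ 2 ≤ 4 * B ^ 2 *
          ∑ h ∈ Ico 1 L, ‖∑ n ∈ range (L - h), f (n + h) * (starRingEnd ℂ) (f n)‖ := by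
        nlinarith
      have h10 : 0 ≤ ∑ h ∈ Ico 1 L, ‖∑ n ∈ range (L - h), f (n + h) * (starRingEnd ℂ) (f n)‖ :=
        sum_nonneg fun _ _ => norm_nonneg _
      nlinarith)
  have h8 : (L : ℝ) / B ^ 5 ≤ ((Ico 1 L).filter fun h => (L : ℝ) / B ^ 5 ≤
      ‖∑ n ∈ range (L - h), f (n + h) * (starRingEnd ℂ) (f n)‖).card := by
    rw [mul_comm] at h7
    exact le_of_mul_le_mul_left h7 hL0
  rw [div_le_iff₀' (by positivity)] at h8
  have h9 : ∀ h ∈ Ico 1 L, ((L : ℝ) / B ^ 5 ≤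
      ‖∑ n ∈ range (L - h), f (n + h) * (starRingEnd ℂ) (f n)‖ ↔ (L : ℝ) ≤ B ^ 5 *
      ‖∑ n ∈ range (L - h), f (n + h) * (starRingEnd ℂ) (f n)‖) := fun h _ =>
    div_le_iff₀' (by positivity)
  rwa [filter_congr h9] at h8

/-- A dense set has many popular differences. -/
theorem many_popular_differences (B : ℝ) (hB : 2 ≤ B) (X : ℕ) (hX : 2 * B ^ 2 ≤ X)
    (T : Finset ℕ) (hT : T ⊆ range X) (hcard : (X : ℝ) ≤ B * T.card) :
    (X : ℝ) ≤ B ^ 5 * ((Ico 1 X).filter fun h =>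
      (X : ℝ) ≤ B ^ 5 * (T.filter fun x => x + h ∈ T).card).card := by
  have h := many_large_correlations B hB X hX (fun n => if n ∈ T then 1 else 0)
    (fun n => by split_ifs <;> simp) (by
      rw [sum_ite_mem, inter_eq_right.2 hT]
      simpa using hcard)
  refine h.trans ?_
  gcongr with h hh
  have h2 : ∀ n, ((if n + h ∈ T then 1 else 0 : ℂ)) * (starRingEnd ℂ) (if n ∈ T then 1 else 0)
      = if n + h ∈ T ∧ n ∈ T then 1 else 0 := by
    intro n
    by_cases h3 : n + h ∈ T <;> by_cases h4 : n ∈ T <;> simp [h3, h4]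
  simp_rw [h2]
  rw [sum_boole, Complex.norm_natCast]
  norm_cast
  refine card_le_card fun n hn => ?_
  simp only [mem_filter] at hn ⊢
  exact ⟨hn.2.2, hn.2.1⟩

end VanDerCorput

/-! ### Recurrence for polynomials and monomials -/

section Recurrence

/-- Absorbs numerical constants into powers of `B`. -/
theorem natCast_le_pow {B : ℝ} (hB : 2 ≤ B) (n : ℕ) : (n : ℝ) ≤ B ^ n := by
  calc (n : ℝ) ≤ ((2 ^ n : ℕ) : ℝ) := by exact_mod_cast Nat.lt_two_pow_self.le
    _ = 2 ^ n := by push_cast; rfl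
    _ ≤ B ^ n := by gcongr

/-- If a polynomial of degree `d` is close to an integer at many points, then its leading
coefficient is close to a rational number with small denominator. -/
theorem polynomial_recurrence (d : ℕ) : ∃ A : ℕ, ∀ (B : ℝ) (X : ℕ) (T : Finset ℕ) (β : ℕ → ℝ)
    (ε : ℝ), 2 ≤ B → B ^ A ≤ X → T ⊆ range X → (X : ℝ) ≤ B * T.card → B ^ A * ε ≤ 1 →
    (∀ x ∈ T, distInt (phase (d + 1) β x) ≤ ε) →
    ∃ q : ℕ, 1 ≤ q ∧ (q : ℝ) ≤ B ^ A ∧ (X : ℝ) ^ d * distInt (q * β d) ≤ B ^ A * ε := by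
  induction d with
  | zero =>
    refine ⟨0, fun B X T β ε hB hX _ hcard _ h => ⟨1, le_rfl, by simp, ?_⟩⟩
    obtain ⟨x, hx⟩ : T.Nonempty := by
      rw [nonempty_iff_ne_empty]
      rintro rfl
      simp at hcard hX
      omega
    simpa [phase] using h x hx
  | succ d ih =>
    obtain ⟨A, ih⟩ := ih
    -- The denominator costs `10(5A + 5)` from `linear_recurrence`, `5A` from the induction and `d +
    -- 1` from the factor `d + 1`; one power is spare.
    refine ⟨55 * A + 52 + d, fun B X T β ε hB hX hT hcard hε h => ?_⟩
    have hB0 : 0 < B := by linarith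
    have hB1 : 1 ≤ B := by linarith
    have hX1 : (1 : ℝ) ≤ X := (one_le_pow₀ hB1).trans hX
    have hTne : T.Nonempty := by
      rw [nonempty_iff_ne_empty]
      rintro rfl
      simp at hcard
      norm_num [hcard] at hX1
    have hε0 : 0 ≤ ε := by
      obtain ⟨x, hx⟩ := hTne
      exact (distInt_nonneg _).trans (h x hx)
    have hX2 : 2 * B ^ 2 ≤ X := by
      calc 2 * B ^ 2 ≤ B * B ^ 2 := by gcongr
        _ = B ^ 3 := by ring
        _ ≤ B ^ (55 * A + 52 + d) := pow_le_pow_right₀ hB1 (by omega)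
        _ ≤ X := hX
    have hpop := many_popular_differences B hB X hX2 T hT hcard
    set G := (Ico 1 X).filter fun h => (X : ℝ) ≤ B ^ 5 * (T.filter fun x => x + h ∈ T).card
    have hB5 : 2 ≤ B ^ 5 := by
      calc (2 : ℝ) ≤ B ^ 1 := by simpa using hB
        _ ≤ B ^ 5 := pow_le_pow_right₀ hB1 (by norm_num)
    -- Differencing by a popular `g` leaves degree `d` and leading coefficient `(d + 1) g β_{d+1}`,
    -- with error at most `2ε` on a dense set. This is linear in `g`, so after fixing `q` the
    -- degree-one case applies with `g` as the variable.
    have key : ∀ g ∈ G, ∃ q : ℕ, 1 ≤ q ∧ (q : ℝ) ≤ B ^ (5 * A) ∧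
        (X : ℝ) ^ d * distInt (q * ((d + 1) * g * β (d + 1))) ≤ B ^ (5 * A + 1) * ε := by
      intro g hg
      obtain ⟨q, hq1, hq2, hq3⟩ := ih (B ^ 5) X (T.filter fun x => x + g ∈ T)
        (diffCoeff (d + 1 + 1) g β) (2 * ε) hB5 (by
          rw [← pow_mul]
          exact (pow_le_pow_right₀ hB1 (by omega)).trans hX) ((filter_subset _ _).trans hT)
        (mem_filter.1 hg).2 (by
          rw [← pow_mul]
          calc B ^ (5 * A) * (2 * ε) ≤ B ^ (5 * A) * (B * ε) := by gcongr
            _ = B ^ (5 * A + 1) * ε := by ring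
            _ ≤ B ^ (55 * A + 52 + d) * ε := by
              gcongr ?_ * _
              exact pow_le_pow_right₀ hB1 (by omega)
            _ ≤ 1 := hε) (by
          intro x hx
          rw [mem_filter] at hx
          rw [← phase_diff]
          refine (distInt_sub _ _).trans ?_
          have h1 := h _ hx.1
          have h2 := h _ hx.2
          push_cast at h2
          linarith)
      rw [← pow_mul] at hq2 hq3
      refine ⟨q, hq1, hq2, ?_⟩
      have h1 : diffCoeff (d + 1 + 1) g β d = (d + 1) * g * β (d + 1) := by
        simp [diffCoeff]
      rw [h1] at hq3
      calc _ ≤ _ := hq3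
        _ ≤ B ^ (5 * A) * (B * ε) := by gcongr
        _ = B ^ (5 * A + 1) * ε := by ring
    choose! Q hQ1 hQ2 hQ3 using key
    obtain ⟨q, hq1, hq2, hq3⟩ := exists_large_fiber G Q (B ^ (5 * A)) (one_le_pow₀ hB1)
      (fun g hg => ⟨hQ1 g hg, hQ2 g hg⟩)
    obtain ⟨p, hp1, hp2, hp3⟩ := linear_recurrence (B ^ (5 * A + 5)) (by
        exact hB5.trans (pow_le_pow_right₀ hB1 (by omega))) X (by exact_mod_cast hX1)
      (G.filter fun g => Q g = q) (by
        intro g hg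
        have := mem_Ico.1 (mem_filter.1 (mem_filter.1 hg).1).1
        exact mem_Icc.2 ⟨this.1, this.2.le⟩) (by
        refine hpop.trans ?_
        calc B ^ 5 * (G.card : ℝ) ≤ B ^ 5 * (B ^ (5 * A) * (G.filter fun g => Q g = q).card) := by
              gcongr
          _ = _ := by ring) (B ^ (5 * A + 1) * ε / X ^ d) (q * ((d + 1) * β (d + 1))) (by
        rw [← mul_div_assoc, div_le_one (by positivity), ← pow_mul, ← mul_assoc, ← pow_add]
        refine le_trans ?_ (hε.trans (one_le_pow₀ hX1))
        gcongr ?_ * _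
        exact pow_le_pow_right₀ hB1 (by omega)) (by
        intro g hg
        rw [mem_filter] at hg
        rw [le_div_iff₀ (by positivity), mul_comm]
        have := hQ3 g hg.1
        rw [hg.2] at this
        rwa [show (g : ℝ) * (q * ((d + 1) * β (d + 1))) = q * ((d + 1) * g * β (d + 1)) by ring])
    rw [← pow_mul] at hp2 hp3
    refine ⟨p * q * (d + 1), Nat.mul_pos (Nat.mul_pos hp1 hq1) d.succ_pos, ?_, ?_⟩
    · push_cast
      calc (p : ℝ) * q * (d + 1) ≤ B ^ ((5 * A + 5) * 10) * B ^ (5 * A) * B ^ (d + 1) := by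
            gcongr
            exact_mod_cast natCast_le_pow hB (d + 1)
        _ = B ^ (55 * A + 51 + d) := by ring
        _ ≤ _ := pow_le_pow_right₀ hB1 (by omega)
    · rw [← mul_div_assoc, le_div_iff₀ (by positivity)] at hp3
      push_cast
      rw [show (p : ℝ) * q * (d + 1) * β (d + 1) = p * (q * ((d + 1) * β (d + 1))) by ring]
      calc (X : ℝ) ^ (d + 1) * distInt (p * (q * ((d + 1) * β (d + 1))))
          = X * distInt (p * (q * ((d + 1) * β (d + 1)))) * X ^ d := by ring
        _ ≤ _ := hp3
        _ = B ^ (55 * A + 51) * ε := by ring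
        _ ≤ _ := by
          gcongr ?_ * _
          exact pow_le_pow_right₀ hB1 (by omega)

/-- If `‖x ^ d β‖` is small for many `x ≤ X`, then `β` is close to a rational number with small
denominator. -/
theorem monomial_recurrence (d : ℕ) : ∃ A : ℕ, ∀ (B : ℝ) (X : ℕ) (T : Finset ℕ) (β ε : ℝ),
    2 ≤ B → 1 ≤ X → T ⊆ Icc 1 X → (X : ℝ) ≤ B * T.card → B ^ A * ε ≤ 1 →
    (∀ x ∈ T, distInt (x ^ d * β) ≤ ε) →
    ∃ q : ℕ, 1 ≤ q ∧ (q : ℝ) ≤ B ^ A ∧ (X : ℝ) ^ d * distInt (q * β) ≤ B ^ A * ε := by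
  obtain ⟨A, hA⟩ := polynomial_recurrence d
  refine ⟨2 * A * (d + 1), fun B X T β ε hB hX hT hcard hε h => ?_⟩
  have hB0 : 0 < B := by linarith
  have hB1 : 1 ≤ B := by linarith
  have hX1 : (1 : ℝ) ≤ X := by exact_mod_cast hX
  have hTne : T.Nonempty := by
    rw [nonempty_iff_ne_empty]
    rintro rfl
    simp at hcard
    omega
  obtain ⟨x, hx⟩ := hTne
  have hε0 : 0 ≤ ε := (distInt_nonneg _).trans (h x hx)
  have hx1 := mem_Icc.1 (hT hx)
  -- For small `X` any `x ∈ T` already gives the denominator `x ^ d`.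
  by_cases hXB : (X : ℝ) ≤ B ^ (2 * A)
  · have h1 : (X : ℝ) ^ d ≤ B ^ (2 * A * (d + 1)) := by
      calc (X : ℝ) ^ d ≤ (B ^ (2 * A)) ^ d := by gcongr
        _ = B ^ (2 * A * d) := by rw [← pow_mul]
        _ ≤ _ := pow_le_pow_right₀ hB1 (by gcongr; omega)
    refine ⟨x ^ d, Nat.one_le_pow _ _ hx1.1, ?_, ?_⟩
    · push_cast
      refine le_trans ?_ h1
      gcongr
      exact hx1.2
    · have := h x hx
      push_cast
      exact mul_le_mul h1 this (distInt_nonneg _) (by positivity)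
  · push Not at hXB
    have hAA : 2 * A ≤ 2 * A * (d + 1) := Nat.le_mul_of_pos_right _ (by omega)
    have hB2 : B ≤ B ^ 2 := by nlinarith
    -- The set lies in `[1, X]`, hence in `range (X + 1)`; replacing `B` by `B ^ 2` pays for `X + 1
    -- ≤ 2X`.
    obtain ⟨q, hq1, hq2, hq3⟩ := hA (B ^ 2) (X + 1) T (fun j => if j = d then β else 0) ε
      (hB.trans hB2) (by
        rw [← pow_mul]; push_cast; linarith) (by
        intro y hy
        have := mem_Icc.1 (hT hy)
        exact mem_range.2 (by omega)) (by
        push_cast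
        calc (X : ℝ) + 1 ≤ 2 * X := by linarith
          _ ≤ B * (B * T.card) := by gcongr
          _ = B ^ 2 * T.card := by ring) (by
        rw [← pow_mul]
        refine le_trans ?_ hε
        gcongr ?_ * _
        exact pow_le_pow_right₀ hB1 hAA) (by
        intro y hy
        have : phase (d + 1) (fun j => if j = d then β else 0) y = y ^ d * β := by
          simp [phase, mul_comm]
        rw [this]
        exact h y hy)
    rw [← pow_mul] at hq2 hq3
    refine ⟨q, hq1, hq2.trans (pow_le_pow_right₀ hB1 hAA), ?_⟩
    simp only [if_true] at hq3
    calc (X : ℝ) ^ d * distInt (q * β) ≤ ((X + 1 : ℕ) : ℝ) ^ d * distInt (q * β) := by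
          gcongr
          · exact distInt_nonneg _
          · omega
      _ ≤ _ := hq3
      _ ≤ _ := by
        gcongr ?_ * _
        exact pow_le_pow_right₀ hB1 hAA

end Recurrence

/-! ### Triangular systems of approximation conditions -/

section Triangular

/-- Solving a triangular system of Diophantine approximation conditions, from the last coefficient
to the first. -/
theorem triangular_recurrence (d : ℕ → ℕ) (a K n : ℕ) : ∀ s : ℕ, s + n = K →
    ∃ A : ℕ, ∀ (B : ℝ) (X : ℕ) (T : Finset ℕ) (α : ℕ → ℝ) (γ : ℕ → ℕ) (c : ℕ → ℕ → ℕ → ℤ)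
      (w : ℕ → ℝ), 2 ≤ B → 1 ≤ X → T ⊆ Icc 1 X → (X : ℝ) ≤ B ^ a * T.card →
      (∀ i ∈ Ico s K, 1 ≤ γ i ∧ (γ i : ℝ) ≤ B ^ a) → (∀ i ∈ Ico s K, 0 < w i) →
      (∀ i ∈ Ico s K, B ^ A * (X : ℝ) ^ d i ≤ w i) →
      (∀ i ∈ Ico s K, ∀ x ∈ T, w i * distInt (γ i * ((x : ℝ) ^ d i * α i) +
        ∑ j ∈ Ico (i + 1) K, c i j x * α j) ≤ B ^ a * (X : ℝ) ^ d i) →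
      (∀ i ∈ Ico s K, ∀ j ∈ Ico (i + 1) K, ∀ x ∈ T,
        |(c i j x : ℝ)| * w i ≤ B ^ a * (X : ℝ) ^ d i * w j) →
      ∃ q : ℕ, 1 ≤ q ∧ (q : ℝ) ≤ B ^ A ∧ ∀ i ∈ Ico s K, w i * distInt (q * α i) ≤ B ^ A := by
  induction n with
  | zero =>
    rintro s rfl
    exact ⟨0, fun B X T α γ c w _ _ _ _ _ _ _ _ _ => ⟨1, le_rfl, by simp, by simp⟩⟩
  | succ n ih =>
    intro s hs
    obtain ⟨A₀, h₀⟩ := ih (s + 1) (by omega)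
    obtain ⟨A₁, h₁⟩ := monomial_recurrence (d s)
    refine ⟨(a + 1) * A₁ + A₀ + a + n + 1,
      fun B X T α γ c w hB hX hT hcard hγ hw hXw hdist hc => ?_⟩
    have hB0 : 0 < B := by linarith
    have hB1 : 1 ≤ B := by linarith
    have hX0 : (0 : ℝ) < X := by exact_mod_cast hX
    have hsub : ∀ i ∈ Ico (s + 1) K, i ∈ Ico s K := fun i hi => by
      rw [mem_Ico] at hi ⊢; omega
    have hsK : s ∈ Ico s K := by rw [mem_Ico]; omega
    obtain ⟨q₀, hq1, hq2, hq3⟩ := h₀ B X T α γ c w hB hX hT hcard (fun i hi => hγ i (hsub i hi))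
      (fun i hi => hw i (hsub i hi)) (fun i hi => by
        refine le_trans ?_ (hXw i (hsub i hi))
        gcongr ?_ * _
        exact pow_le_pow_right₀ hB1 (by omega)) (fun i hi => hdist i (hsub i hi))
      (fun i hi => hc i (hsub i hi))
    have hws := hw s hsK
    -- Multiply the relation in row `s` by `q₀` and subtract the later columns. Each of these is an
    -- integer multiple of some `q₀ α_j`, already near an integer, and the size condition on `c`
    -- controls the multiplier.
    have hpt : ∀ x ∈ T, distInt ((x : ℝ) ^ d s * (q₀ * (γ s * α s))) ≤
        B ^ (A₀ + a + n + 1) * X ^ d s / w s := by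
      intro x hx
      have hid : (x : ℝ) ^ d s * (q₀ * (γ s * α s)) =
          q₀ * (γ s * ((x : ℝ) ^ d s * α s) + ∑ j ∈ Ico (s + 1) K, c s j x * α j) -
            ∑ j ∈ Ico (s + 1) K, c s j x * (q₀ * α j) := by
        rw [mul_add, mul_sum]
        have : ∀ j ∈ Ico (s + 1) K, (q₀ : ℝ) * (c s j x * α j) = c s j x * (q₀ * α j) :=
          fun j _ => by ring
        rw [sum_congr rfl this]
        ring
      rw [le_div_iff₀ hws, mul_comm, hid]
      have h2 : w s * distInt (q₀ * (γ s * ((x : ℝ) ^ d s * α s) +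
          ∑ j ∈ Ico (s + 1) K, c s j x * α j)) ≤ B ^ (A₀ + a) * X ^ d s := by
        calc _ ≤ w s * (q₀ * distInt (γ s * ((x : ℝ) ^ d s * α s) +
              ∑ j ∈ Ico (s + 1) K, c s j x * α j)) := by gcongr; exact distInt_nat_mul _ _
          _ = q₀ * (w s * distInt (γ s * ((x : ℝ) ^ d s * α s) +
              ∑ j ∈ Ico (s + 1) K, c s j x * α j)) := by ring
          _ ≤ B ^ A₀ * (B ^ a * X ^ d s) := mul_le_mul hq2 (hdist s hsK x hx)
              (mul_nonneg hws.le (distInt_nonneg _)) (by positivity)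
          _ = _ := by ring
      have h3 : ∀ j ∈ Ico (s + 1) K, w s * distInt (c s j x * (q₀ * α j)) ≤
          B ^ (A₀ + a) * X ^ d s := by
        intro j hj
        have hwj := hw j (hsub j hj)
        refine le_of_mul_le_mul_right ?_ hwj
        calc w s * distInt (c s j x * (q₀ * α j)) * w j
            ≤ w s * (|(c s j x : ℝ)| * distInt (q₀ * α j)) * w j := by
              gcongr; exact distInt_int_mul _ _
          _ = (|(c s j x : ℝ)| * w s) * (w j * distInt (q₀ * α j)) := by ring
          _ ≤ (B ^ a * (X : ℝ) ^ d s * w j) * B ^ A₀ := mul_le_mul (hc s hsK j hj x hx)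
              (hq3 j hj) (mul_nonneg hwj.le (distInt_nonneg _)) (by positivity)
          _ = _ := by ring
      calc _ ≤ w s * (distInt (q₀ * (γ s * ((x : ℝ) ^ d s * α s) +
            ∑ j ∈ Ico (s + 1) K, c s j x * α j)) +
            ∑ j ∈ Ico (s + 1) K, distInt (c s j x * (q₀ * α j))) := by
              gcongr
              exact (distInt_sub _ _).trans (by gcongr; exact distInt_sum _ _)
        _ = w s * distInt (q₀ * (γ s * ((x : ℝ) ^ d s * α s) +
            ∑ j ∈ Ico (s + 1) K, c s j x * α j)) +
            ∑ j ∈ Ico (s + 1) K, w s * distInt (c s j x * (q₀ * α j)) := by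
              rw [mul_add, mul_sum]
        _ ≤ B ^ (A₀ + a) * X ^ d s + n * (B ^ (A₀ + a) * X ^ d s) := by
              gcongr
              refine (sum_le_card_nsmul _ _ _ h3).trans ?_
              rw [Nat.card_Ico, show K - (s + 1) = n by omega, nsmul_eq_mul]
        _ = ((n + 1 : ℕ) : ℝ) * (B ^ (A₀ + a) * X ^ d s) := by push_cast; ring
        _ ≤ B ^ (n + 1) * (B ^ (A₀ + a) * X ^ d s) := by gcongr; exact natCast_le_pow hB _
        _ = _ := by ring
    have hBa : B ^ a ≤ B ^ (a + 1) := pow_le_pow_right₀ hB1 (by omega)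
    obtain ⟨q₁, hp1, hp2, hp3⟩ := h₁ (B ^ (a + 1)) X T (q₀ * (γ s * α s))
      (B ^ (A₀ + a + n + 1) * X ^ d s / w s)
      (by
        calc (2 : ℝ) ≤ B ^ 1 := by simpa using hB
          _ ≤ B ^ (a + 1) := pow_le_pow_right₀ hB1 (by omega)) hX hT
      (hcard.trans (by gcongr)) (by
        rw [← mul_div_assoc, div_le_one hws, ← pow_mul, ← mul_assoc, ← pow_add]
        rw [show (a + 1) * A₁ + (A₀ + a + n + 1) = (a + 1) * A₁ + A₀ + a + n + 1 by ring]
        exact hXw s hsK) hpt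
    rw [← pow_mul] at hp2 hp3
    refine ⟨q₁ * q₀ * γ s, Nat.mul_pos (Nat.mul_pos hp1 hq1) (hγ s hsK).1, ?_, ?_⟩
    · push_cast
      calc (q₁ : ℝ) * q₀ * γ s ≤ B ^ ((a + 1) * A₁) * B ^ A₀ * B ^ a := by
            gcongr; exact (hγ s hsK).2
        _ = B ^ ((a + 1) * A₁ + A₀ + a) := by ring
        _ ≤ _ := pow_le_pow_right₀ hB1 (by omega)
    · intro i hi
      by_cases his : i = s
      · subst his
        refine le_of_mul_le_mul_left ?_ (by positivity : (0 : ℝ) < X ^ d i)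
        push_cast
        rw [mul_assoc (q₁ : ℝ), mul_assoc (q₁ : ℝ), mul_assoc (q₀ : ℝ)]
        rw [← mul_div_assoc, le_div_iff₀ hws] at hp3
        calc _ = (X : ℝ) ^ d i * distInt (q₁ * (q₀ * (γ i * α i))) * w i := by ring
          _ ≤ _ := hp3
          _ = _ := by ring
      · have hi' : i ∈ Ico (s + 1) K := by
          rw [mem_Ico] at hi ⊢; omega
        have h4 : ((q₁ * q₀ * γ s : ℕ) : ℝ) * α i = ((q₁ * γ s : ℕ) : ℝ) * (q₀ * α i) := by
          push_cast; ring
        rw [h4]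
        have hwi := hw i hi
        calc w i * distInt (((q₁ * γ s : ℕ) : ℝ) * (q₀ * α i))
            ≤ w i * (((q₁ * γ s : ℕ) : ℝ) * distInt (q₀ * α i)) := by
              gcongr; exact distInt_nat_mul _ _
          _ = q₁ * γ s * (w i * distInt (q₀ * α i)) := by push_cast; ring
          _ ≤ B ^ ((a + 1) * A₁) * B ^ a * B ^ A₀ := by
              gcongr
              · exact mul_nonneg hwi.le (distInt_nonneg _)
              · exact (hγ s hsK).2
              · exact hq3 i hi'
          _ = B ^ ((a + 1) * A₁ + A₀ + a) := by ring
          _ ≤ _ := pow_le_pow_right₀ hB1 (by omega)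

end Triangular

/-! ### The linear coefficient of a phase with a large sum -/

section Weyl

/-- Moving by multiples of `q` changes a polynomial phase almost linearly when the higher
coefficients are well approximated by fractions with denominator `q`. -/
theorem distInt_phase_shift (B : ℝ) (hB : 2 ≤ B) (D E K L T q : ℕ) (β : ℕ → ℝ) (hL : 1 ≤ L)
    (hT : (T : ℝ) * B ^ E ≤ L) (hq : ∀ j ∈ Ico 2 (K + 2), (L : ℝ) ^ j * distInt (q * β j) ≤ B ^ D)
    (n t : ℕ) (hn : n ≤ L) (ht : t ≤ T) (hqt : q * t ≤ L) :
    distInt (phase (K + 2) β ((n + q * t : ℕ) : ℝ) - (phase (K + 2) β n + t * (q * β 1))) * B ^ E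
      ≤ B ^ (D + 3 * K + 2) := by
  have hB0 : 0 < B := by linarith
  have hB1 : 1 ≤ B := by linarith
  have hL0 : (0 : ℝ) < L := by exact_mod_cast hL
  -- Since `qt` divides `(n + qt)^j - n^j`, every term of degree at least two is an integer multiple
  -- of `q β_j`.
  have hid : phase (K + 2) β ((n + q * t : ℕ) : ℝ) - (phase (K + 2) β n + t * (q * β 1)) =
      ∑ j ∈ Ico 2 (K + 2), ((t * ∑ i ∈ range j, (n + q * t) ^ i * n ^ (j - 1 - i) : ℕ) : ℝ) *
        (q * β j) := by
    unfold phase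
    rw [← sub_sub, ← sum_sub_distrib, range_eq_Ico, sum_eq_sum_Ico_succ_bot (by omega),
      sum_eq_sum_Ico_succ_bot (by omega)]
    have h1 : ∀ j ∈ Ico (0 + 1 + 1) (K + 2), β j * ((n + q * t : ℕ) : ℝ) ^ j - β j * (n : ℝ) ^ j =
        ((t * ∑ i ∈ range j, (n + q * t) ^ i * n ^ (j - 1 - i) : ℕ) : ℝ) * (q * β j) := by
      intro j _
      have h2 := (Commute.all ((n + q * t : ℕ) : ℝ) (n : ℝ)).geom_sum₂_mul j
      rw [← mul_sub, ← h2]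
      push_cast
      ring
    rw [sum_congr rfl h1]
    push_cast
    ring
  rw [hid]
  have hterm : ∀ j ∈ Ico 2 (K + 2),
      distInt (((t * ∑ i ∈ range j, (n + q * t) ^ i * n ^ (j - 1 - i) : ℕ) : ℝ) * (q * β j)) * B ^ E
        ≤ B ^ (D + 2 * K + 2) := by
    intro j hj
    have hj1 := mem_Ico.1 hj
    refine le_of_mul_le_mul_right ?_ (by positivity : (0 : ℝ) < L ^ j)
    have hs : ((∑ i ∈ range j, (n + q * t) ^ i * n ^ (j - 1 - i) : ℕ) : ℝ) ≤
        B ^ (2 * K + 2) * L ^ (j - 1) := by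
      have h1 : ∀ i ∈ range j, (n + q * t) ^ i * n ^ (j - 1 - i) ≤ 2 ^ (j - 1) * L ^ (j - 1) := by
        intro i hi
        have hi := mem_range.1 hi
        calc (n + q * t) ^ i * n ^ (j - 1 - i) ≤ (2 * L) ^ i * (2 * L) ^ (j - 1 - i) := by
              gcongr <;> omega
          _ = 2 ^ (j - 1) * L ^ (j - 1) := by
              rw [← pow_add, ← mul_pow]
              congr 1
              omega
      have h2 : ((∑ i ∈ range j, (n + q * t) ^ i * n ^ (j - 1 - i) : ℕ) : ℝ) ≤
          j * ((2 : ℝ) ^ (j - 1) * L ^ (j - 1)) := by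
        have := sum_le_card_nsmul _ _ _ h1
        rw [card_range, smul_eq_mul] at this
        exact_mod_cast this
      calc _ ≤ _ := h2
        _ ≤ B ^ j * (B ^ (j - 1) * L ^ (j - 1)) := by
            gcongr
            exact natCast_le_pow hB j
        _ = B ^ (j + (j - 1)) * L ^ (j - 1) := by rw [pow_add]; ring
        _ ≤ _ := by
            gcongr ?_ * _
            exact pow_le_pow_right₀ hB1 (by omega)
    calc _ ≤ ((t * ∑ i ∈ range j, (n + q * t) ^ i * n ^ (j - 1 - i) : ℕ) : ℝ) *
            distInt (q * β j) * B ^ E * L ^ j := by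
          gcongr
          exact distInt_nat_mul _ _
      _ = (t * B ^ E) * ((∑ i ∈ range j, (n + q * t) ^ i * n ^ (j - 1 - i) : ℕ) : ℝ) *
          (L ^ j * distInt (q * β j)) := by push_cast; ring
      _ ≤ (T * B ^ E) * (B ^ (2 * K + 2) * L ^ (j - 1)) * B ^ D := by
          have := hq j hj
          have := distInt_nonneg (q * β j)
          gcongr
      _ ≤ L * (B ^ (2 * K + 2) * L ^ (j - 1)) * B ^ D := by gcongr
      _ = B ^ (D + 2 * K + 2) * (L ^ (j - 1) * L) := by ring
      _ = B ^ (D + 2 * K + 2) * L ^ j := by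
          rw [← pow_succ]
          congr 2
          omega
  calc _ ≤ (∑ j ∈ Ico 2 (K + 2),
        distInt (((t * ∑ i ∈ range j, (n + q * t) ^ i * n ^ (j - 1 - i) : ℕ) : ℝ) * (q * β j))) *
          B ^ E := by gcongr; exact distInt_sum _ _
    _ ≤ K * B ^ (D + 2 * K + 2) := by
        rw [sum_mul]
        refine (sum_le_card_nsmul _ _ _ hterm).trans ?_
        rw [Nat.card_Ico, nsmul_eq_mul, Nat.add_sub_cancel]
    _ ≤ B ^ K * B ^ (D + 2 * K + 2) := by gcongr; exact natCast_le_pow hB K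
    _ = _ := by ring

/-- If an exponential sum is large and the coefficients of degree at least two are well
approximated by fractions with denominator `q`, then so is the linear coefficient. -/
theorem linear_coefficient (B : ℝ) (hB : 2 ≤ B) (D K L q : ℕ) (β : ℕ → ℝ) (hq1 : 1 ≤ q)
    (hqB : (q : ℝ) ≤ B ^ D)
    (hq : ∀ j ∈ Ico 2 (K + 2), (L : ℝ) ^ j * distInt (q * β j) ≤ B ^ D)
    (hsum : (L : ℝ) ≤ B * ‖∑ n ∈ range L, e (phase (K + 2) β n)‖) :
    L * distInt (q * β 1) ≤ B ^ (D + 3 * K + 12) := by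
  have hB0 : 0 < B := by linarith
  have hB1 : 1 ≤ B := by linarith
  -- The six powers above `D + 3K + 2` make the phase error at most `1/(4B)` after the constant `8`
  -- of `norm_e_sub_e_le`.
  set E := D + 3 * K + 8 with hE
  by_cases hLE : (L : ℝ) ≤ B ^ E
  · calc L * distInt (q * β 1) ≤ B ^ E * 1 := by
          have := distInt_le_half (q * β 1)
          have := distInt_nonneg (q * β 1)
          gcongr
          linarith
      _ ≤ _ := by rw [mul_one]; exact pow_le_pow_right₀ hB1 (by omega)
  push Not at hLE
  have hBE : 1 ≤ B ^ E := one_le_pow₀ hB1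
  have hL0 : (0 : ℝ) < L := by linarith
  have hL1 : 1 ≤ L := by exact_mod_cast hL0
  set T := ⌊(L : ℝ) / B ^ E⌋₊ with hT
  have hT1 : (T : ℝ) * B ^ E ≤ L := by
    rw [← le_div_iff₀ (by positivity)]
    exact Nat.floor_le (by positivity)
  have hT2 : (1 : ℝ) ≤ T := by
    have : 1 ≤ T := Nat.le_floor (by
      rw [le_div_iff₀ (by positivity)]; push_cast; linarith)
    exact_mod_cast this
  have hT3 : (L : ℝ) ≤ 2 * T * B ^ E := by
    have := (div_lt_iff₀ (by positivity)).1 (Nat.lt_floor_add_one ((L : ℝ) / B ^ E))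
    rw [← hT] at this
    nlinarith
  set f : ℕ → ℂ := fun n => e (phase (K + 2) β n) with hf
  have hf1 : ∀ n, ‖f n‖ ≤ 1 := fun n => (norm_e _).le
  have hqT : 4 * B * (q * T) ≤ L := by
    calc 4 * B * (q * T) ≤ B ^ 2 * B * (B ^ D * T) := by
          gcongr
          nlinarith
      _ = T * B ^ (D + 3) := by ring
      _ ≤ T * B ^ E := by
          gcongr ?_ * ?_
          exact pow_le_pow_right₀ hB1 (by omega)
      _ ≤ L := hT1
  -- Shifting the range by `qt` alters at most `2qT` unimodular terms, and `4BqT ≤ L`, so averaging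
  -- over shifts loses at most half of the lower bound.
  have h1 : (T : ℝ) * L ≤ 2 * B * ‖∑ n ∈ range L, ∑ t ∈ range T, f (n + q * t)‖ := by
    have h2 : ∑ n ∈ range L, ∑ t ∈ range T, f (n + q * t) - T * ∑ n ∈ range L, f n =
        ∑ t ∈ range T, (∑ n ∈ range L, f (n + q * t) - ∑ n ∈ range L, f n) := by
      rw [sum_comm, sum_sub_distrib, sum_const, card_range, nsmul_eq_mul]
    have h3 : ‖∑ n ∈ range L, ∑ t ∈ range T, f (n + q * t) - T * ∑ n ∈ range L, f n‖ ≤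
        T * (2 * (q * T)) := by
      rw [h2]
      refine (norm_sum_le _ _).trans ((sum_le_card_nsmul _ _ (2 * (q * T) : ℝ)
        fun t ht => ?_).trans (by simp))
      have h4 : ∑ n ∈ range L, f (n + q * t) - ∑ n ∈ range L, f n =
          ∑ n ∈ range (q * t), f (L + n) - ∑ n ∈ range (q * t), f n := by
        have h5 := sum_range_add f L (q * t)
        have h6 := sum_range_add f (q * t) L
        rw [add_comm (q * t) L, h5] at h6
        have h7 : ∑ n ∈ range L, f (n + q * t) = ∑ n ∈ range L, f (q * t + n) :=
          sum_congr rfl fun n _ => by rw [add_comm]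
        rw [h7]
        linear_combination -h6
      have h5 : ∀ g : ℕ → ℂ, (∀ n, ‖g n‖ ≤ 1) → ‖∑ n ∈ range (q * t), g n‖ ≤ q * T := fun g hg =>
        (norm_sum_le _ _).trans ((sum_le_card_nsmul _ _ 1 fun n _ => hg n).trans (by
          rw [card_range, nsmul_eq_mul, mul_one]
          push_cast
          gcongr
          exact (mem_range.1 ht).le))
      rw [h4]
      have h6 := h5 (fun n => f (L + n)) fun n => hf1 _
      have h7 := h5 f hf1
      have h8 := norm_sub_le (∑ n ∈ range (q * t), f (L + n)) (∑ n ∈ range (q * t), f n)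
      linarith
    have h4 : T * ‖∑ n ∈ range L, f n‖ ≤
        ‖∑ n ∈ range L, ∑ t ∈ range T, f (n + q * t)‖ + T * (2 * (q * T)) := by
      have h5 := norm_sub_norm_le ((T : ℂ) * ∑ n ∈ range L, f n)
        (∑ n ∈ range L, ∑ t ∈ range T, f (n + q * t))
      rw [norm_sub_rev, norm_mul, Complex.norm_natCast] at h5
      linarith
    have h5 : (T : ℝ) * L ≤ T * (B * ‖∑ n ∈ range L, f n‖) := by gcongr
    have h6 : (T : ℝ) * (4 * B * (q * T)) ≤ T * L := by gcongr
    nlinarith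
  obtain ⟨n, hn, hn2⟩ : ∃ n ∈ range L, (T : ℝ) ≤ 2 * B * ‖∑ t ∈ range T, f (n + q * t)‖ := by
    by_contra! hcon
    have h2 : ∑ n ∈ range L, 2 * B * ‖∑ t ∈ range T, f (n + q * t)‖ < ∑ n ∈ range L, (T : ℝ) :=
      sum_lt_sum_of_nonempty ⟨0, mem_range.2 hL1⟩ hcon
    rw [sum_const, card_range, nsmul_eq_mul, ← mul_sum] at h2
    have h3 : 2 * B * ‖∑ n ∈ range L, ∑ t ∈ range T, f (n + q * t)‖ ≤
        2 * B * ∑ n ∈ range L, ‖∑ t ∈ range T, f (n + q * t)‖ := by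
      gcongr
      exact norm_sum_le _ _
    linarith
  have h2 : ∀ t ∈ range T, ‖f (n + q * t) - f n * e (t * (q * β 1))‖ * (4 * B) ≤ 1 := by
    intro t ht
    have ht := (mem_range.1 ht).le
    have h3 := distInt_phase_shift B hB D E K L T q β hL1 hT1 hq n t (mem_range.1 hn).le ht (by
      have h4 : (q : ℝ) * t ≤ L := by
        calc (q : ℝ) * t ≤ 1 * (q * T) := by rw [one_mul]; gcongr
          _ ≤ 4 * B * (q * T) := by gcongr; linarith
          _ ≤ L := hqT
      exact_mod_cast h4)
    simp only [hf]
    rw [← e_add]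
    refine le_of_mul_le_mul_right ?_ (by positivity : 0 < B ^ E)
    calc _ ≤ 8 * distInt (phase (K + 2) β ((n + q * t : ℕ) : ℝ) -
          (phase (K + 2) β n + t * (q * β 1))) * (4 * B) * B ^ E := by
          gcongr
          exact norm_e_sub_e_le _ _
      _ = 2 ^ 5 * B * (distInt (phase (K + 2) β ((n + q * t : ℕ) : ℝ) -
          (phase (K + 2) β n + t * (q * β 1))) * B ^ E) := by ring
      _ ≤ B ^ 5 * B * B ^ (D + 3 * K + 2) := by
          have := distInt_nonneg (phase (K + 2) β ((n + q * t : ℕ) : ℝ) -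
            (phase (K + 2) β n + t * (q * β 1)))
          gcongr
      _ = 1 * B ^ E := by rw [hE]; ring
  have h3 : ‖∑ t ∈ range T, f (n + q * t)‖ * (4 * B) ≤
      T + ‖∑ t ∈ range T, e (t * (q * β 1))‖ * (4 * B) := by
    have h4 : ‖∑ t ∈ range T, (f (n + q * t) - f n * e (t * (q * β 1)))‖ * (4 * B) ≤ T := by
      calc _ ≤ (∑ t ∈ range T, ‖f (n + q * t) - f n * e (t * (q * β 1))‖) * (4 * B) := by
            gcongr
            exact norm_sum_le _ _
        _ ≤ T := by
            rw [sum_mul]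
            exact (sum_le_card_nsmul _ _ 1 h2).trans (by simp)
    have h5 := norm_sub_norm_le (∑ t ∈ range T, f (n + q * t)) (f n * ∑ t ∈ range T, e (t * (q * β 1)))
    rw [norm_mul, show ‖f n‖ = 1 from norm_e _, one_mul, mul_sum, ← sum_sub_distrib] at h5
    nlinarith
  -- On the chosen progression the phase is nearly linear, so the sum there is close to a geometric
  -- sum, which must itself be large.
  have h4 : (T : ℝ) ≤ ‖∑ t ∈ range T, e (t * (q * β 1))‖ * (4 * B) := by linarith
  have h5 : (T : ℝ) * distInt (q * β 1) ≤ 4 * B := by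
    calc (T : ℝ) * distInt (q * β 1) ≤
          ‖∑ t ∈ range T, e (t * (q * β 1))‖ * (4 * B) * distInt (q * β 1) := by
          gcongr
          exact distInt_nonneg _
      _ = (‖∑ t ∈ range T, e (t * (q * β 1))‖ * distInt (q * β 1)) * (4 * B) := by ring
      _ ≤ 1 * (4 * B) := by gcongr; exact norm_geom_sum_mul_distInt_le _ _
      _ = 4 * B := one_mul _
  calc L * distInt (q * β 1) ≤ 2 * T * B ^ E * distInt (q * β 1) := by
        gcongr
        exact distInt_nonneg _
    _ = 2 * B ^ E * (T * distInt (q * β 1)) := by ring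
    _ ≤ 2 * B ^ E * (4 * B) := by gcongr
    _ = 2 ^ 3 * (B ^ E * B) := by ring
    _ ≤ B ^ 3 * (B ^ E * B) := by gcongr
    _ = _ := by rw [hE]; ring

end Weyl

/-! ### The inverse Weyl inequality -/

section Weyl

/-- Weyl's inequality in inverse form: the coefficients of a polynomial with a large exponential sum
are simultaneously well approximated by fractions with a common small denominator. -/
theorem weyl_inverse (k : ℕ) : ∃ A : ℕ, ∀ (B : ℝ) (L : ℕ) (β : ℕ → ℝ), 2 ≤ B →
    (L : ℝ) ≤ B * ‖∑ n ∈ range L, e (phase (k + 1) β n)‖ →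
    ∃ q : ℕ, 1 ≤ q ∧ (q : ℝ) ≤ B ^ A ∧
      ∀ j ∈ Ico 1 (k + 1), (L : ℝ) ^ j * distInt (q * β j) ≤ B ^ A := by
  induction k with
  | zero => exact ⟨0, fun B L β _ _ => ⟨1, le_rfl, by simp, by simp⟩⟩
  | succ k ih =>
    obtain ⟨A, ih⟩ := ih
    set a := 5 * A + 5 * k + 7 with ha
    -- The system starts at index 2: after differencing, `β 1` occurs only in the constant
    -- coefficient, on which the induction hypothesis says nothing.
    obtain ⟨D, hD⟩ := triangular_recurrence (fun _ => 1) a (k + 2) k 2 (by omega)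
    refine ⟨D + 3 * k + 12 + (D + 3) * (k + 2), fun B L β hB hsum => ?_⟩
    have hB0 : 0 < B := by linarith
    have hB1 : 1 ≤ B := by linarith
    by_cases hLD : (L : ℝ) ≤ B ^ (D + 3)
    · refine ⟨1, le_rfl, by simpa using one_le_pow₀ hB1, fun j hj => ?_⟩
      rw [mem_Ico] at hj
      calc (L : ℝ) ^ j * distInt ((1 : ℕ) * β j) ≤ (B ^ (D + 3)) ^ j * 1 := by
            have := distInt_nonneg ((1 : ℕ) * β j)
            gcongr
            exact (distInt_le_half _).trans (by norm_num)
        _ = B ^ ((D + 3) * j) := by rw [mul_one, pow_mul]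
        _ ≤ B ^ ((D + 3) * (k + 2)) := pow_le_pow_right₀ hB1 (by gcongr; omega)
        _ ≤ _ := pow_le_pow_right₀ hB1 (by omega)
    push Not at hLD
    have hL0 : (0 : ℝ) < L := lt_trans (by positivity) hLD
    have hL1 : 1 ≤ L := by exact_mod_cast hL0
    have hL2 : 2 * B ^ 2 ≤ L := by
      calc 2 * B ^ 2 ≤ B * B ^ 2 := by gcongr
        _ = B ^ 3 := by ring
        _ ≤ B ^ (D + 3) := pow_le_pow_right₀ hB1 (by omega)
        _ ≤ L := hLD.le
    have hcorr := many_large_correlations B hB L hL2 (fun n => e (phase (k + 1 + 1) β n))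
      (fun n => (norm_e _).le) hsum
    set G := (Ico 1 L).filter fun h => (L : ℝ) ≤ B ^ 5 * ‖∑ n ∈ range (L - h),
      e (phase (k + 1 + 1) β ((n + h : ℕ) : ℝ)) *
        (starRingEnd ℂ) (e (phase (k + 1 + 1) β n))‖ with hG
    have hB5 : 2 ≤ B ^ 5 := by
      calc (2 : ℝ) ≤ B ^ 1 := by simpa using hB
        _ ≤ B ^ 5 := pow_le_pow_right₀ hB1 (by norm_num)
    have key : ∀ g ∈ G, ∃ q : ℕ, 1 ≤ q ∧ (q : ℝ) ≤ B ^ (5 * A) ∧ ∀ j ∈ Ico 1 (k + 1),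
        (L : ℝ) ^ j * distInt (q * diffCoeff (k + 1 + 1) g β j) ≤ B ^ (5 * A + 5 * k) := by
      intro g hg
      have hg2 := (mem_filter.1 hg).2
      have hgL := mem_Ico.1 (mem_filter.1 hg).1
      have h1 : ∑ n ∈ range (L - g), e (phase (k + 1 + 1) β ((n + g : ℕ) : ℝ)) *
          (starRingEnd ℂ) (e (phase (k + 1 + 1) β n)) =
          ∑ n ∈ range (L - g), e (phase (k + 1) (diffCoeff (k + 1 + 1) g β) n) := by
        refine sum_congr rfl fun n _ => ?_
        rw [← e_sub]
        push_cast
        rw [phase_diff]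
      rw [h1] at hg2
      -- A large correlation needs a long overlap, so bounds in terms of `L - g` can be restated in
      -- terms of `L`.
      have h2 : (L : ℝ) ≤ B ^ 5 * ((L - g : ℕ) : ℝ) := by
        refine hg2.trans ?_
        gcongr
        exact (norm_sum_le _ _).trans ((sum_le_card_nsmul _ _ 1 fun n _ => (norm_e _).le).trans
          (by simp))
      obtain ⟨q, hq1, hq2, hq3⟩ := ih (B ^ 5) (L - g) _ hB5
        (le_trans (by exact_mod_cast Nat.sub_le L g) hg2)
      rw [← pow_mul] at hq2
      refine ⟨q, hq1, hq2, fun j hj => ?_⟩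
      have hq3 := hq3 j hj
      rw [← pow_mul] at hq3
      rw [mem_Ico] at hj
      have h3 := distInt_nonneg (q * diffCoeff (k + 1 + 1) g β j)
      calc _ ≤ (B ^ 5 * ((L - g : ℕ) : ℝ)) ^ j * distInt (q * diffCoeff (k + 1 + 1) g β j) := by
            gcongr
        _ = B ^ (5 * j) * (((L - g : ℕ) : ℝ) ^ j * distInt (q * diffCoeff (k + 1 + 1) g β j)) := by
            rw [mul_pow, pow_mul]; ring
        _ ≤ B ^ (5 * k) * B ^ (5 * A) := by
            gcongr
            omega
        _ = _ := by ring
    choose! Q hQ1 hQ2 hQ3 using key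
    obtain ⟨q, hq1, hq2, hq3⟩ := exists_large_fiber G Q (B ^ (5 * A)) (one_le_pow₀ hB1)
      (fun g hg => ⟨hQ1 g hg, hQ2 g hg⟩)
    -- The coefficient of degree `i - 1` after differencing by `g` is `i g β_i` plus terms in higher
    -- `β_j`. It is linear in `g` on the diagonal, whence `γ i = q i`, exponent `1` and weight `L ^
    -- i`.
    obtain ⟨p, hp1, hp2, hp3⟩ := hD B L (G.filter fun g => Q g = q) β (fun i => q * i)
      (fun i j x => q * j.choose (i - 1) * x ^ (j - (i - 1))) (fun i => (L : ℝ) ^ i) hB hL1 (by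
        intro g hg
        have := mem_Ico.1 (mem_filter.1 (mem_filter.1 hg).1).1
        exact mem_Icc.2 ⟨this.1, this.2.le⟩) (by
        refine hcorr.trans ?_
        calc B ^ 5 * (G.card : ℝ) ≤ B ^ 5 * (B ^ (5 * A) * (G.filter fun g => Q g = q).card) := by
              gcongr
          _ = B ^ (5 + 5 * A) * (G.filter fun g => Q g = q).card := by ring
          _ ≤ _ := by
              gcongr ?_ * _
              exact pow_le_pow_right₀ hB1 (by omega)) (by
        intro i hi
        rw [mem_Ico] at hi
        refine ⟨Nat.mul_pos hq1 (by omega), ?_⟩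
        push_cast
        calc (q : ℝ) * i ≤ B ^ (5 * A) * B ^ i := by
              gcongr; exact natCast_le_pow hB i
          _ = B ^ (5 * A + i) := by ring
          _ ≤ _ := pow_le_pow_right₀ hB1 (by omega)) (fun i _ => by positivity) (by
        intro i hi
        rw [mem_Ico] at hi
        calc B ^ D * (L : ℝ) ^ 1 ≤ L * (L : ℝ) ^ 1 := by
              gcongr
              exact (pow_le_pow_right₀ hB1 (by omega)).trans hLD.le
          _ = (L : ℝ) ^ 2 := by ring
          _ ≤ (L : ℝ) ^ i := pow_le_pow_right₀ (by exact_mod_cast hL1) hi.1) (by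
        intro i hi x hx
        rw [mem_Ico] at hi
        rw [mem_filter] at hx
        obtain ⟨i, rfl⟩ : ∃ i', i = i' + 1 := ⟨i - 1, by omega⟩
        have h1 := hQ3 x hx.1 i (mem_Ico.2 ⟨by omega, by omega⟩)
        rw [hx.2] at h1
        have h2 : (((q * (i + 1) : ℕ) : ℝ)) * ((x : ℝ) ^ 1 * β (i + 1)) +
            ∑ j ∈ Ico (i + 1 + 1) (k + 2),
              ((q * j.choose (i + 1 - 1) * x ^ (j - (i + 1 - 1)) : ℤ) : ℝ) * β j =
            q * diffCoeff (k + 1 + 1) x β i := by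
          unfold diffCoeff
          rw [sum_eq_sum_Ico_succ_bot (show i + 1 < k + 1 + 1 by omega), mul_add (q : ℝ), mul_sum]
          congr 1
          · simp
            ring
          · refine sum_congr rfl fun j _ => ?_
            push_cast
            ring
        rw [h2]
        calc _ = L * ((L : ℝ) ^ i * distInt (q * diffCoeff (k + 1 + 1) x β i)) := by ring
          _ ≤ L * B ^ (5 * A + 5 * k) := by gcongr
          _ = B ^ (5 * A + 5 * k) * (L : ℝ) ^ 1 := by ring
          _ ≤ _ := by
              gcongr ?_ * _
              exact pow_le_pow_right₀ hB1 (by omega)) (by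
        intro i hi j hj x hx
        rw [mem_Ico] at hi hj
        have hxL : (x : ℝ) ≤ L := by
          have := mem_Ico.1 (mem_filter.1 (mem_filter.1 hx).1).1
          exact_mod_cast this.2.le
        push_cast
        rw [abs_of_nonneg (by positivity)]
        have h1 : ((j.choose (i - 1) : ℕ) : ℝ) ≤ B ^ j := by
          calc ((j.choose (i - 1) : ℕ) : ℝ) ≤ ((2 ^ j : ℕ) : ℝ) := by
                exact_mod_cast Nat.choose_le_two_pow _ _
            _ = 2 ^ j := by push_cast; rfl
            _ ≤ B ^ j := by gcongr
        calc (q : ℝ) * (j.choose (i - 1) : ℕ) * (x : ℝ) ^ (j - (i - 1)) * (L : ℝ) ^ i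
            ≤ B ^ (5 * A) * B ^ j * (L : ℝ) ^ (j - (i - 1)) * (L : ℝ) ^ i := by gcongr
          _ = B ^ (5 * A + j) * (L ^ (j - (i - 1) + i)) := by rw [pow_add, pow_add]; ring
          _ = B ^ (5 * A + j) * (L : ℝ) ^ (1 + j) := by
              congr 2
              omega
          _ ≤ B ^ a * (L : ℝ) ^ (1 + j) := by
              gcongr ?_ * _
              exact pow_le_pow_right₀ hB1 (by omega)
          _ = _ := by ring)
    have hlin := linear_coefficient B hB D k L p β hp1 hp2 hp3 hsum
    refine ⟨p, hp1, hp2.trans (pow_le_pow_right₀ hB1 (by omega)), fun j hj => ?_⟩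
    rw [mem_Ico] at hj
    by_cases hj1 : j = 1
    · subst hj1
      rw [pow_one]
      exact hlin.trans (pow_le_pow_right₀ hB1 (by omega))
    · exact (hp3 j (mem_Ico.2 (by omega))).trans (pow_le_pow_right₀ hB1 (by omega))

end Weyl

/-! ### Moments of divisor functions -/

section Divisor

open ArithmeticFunction

/-- The `r`-fold Dirichlet convolution power of the constant function one. -/
def zetaPow (r : ℕ) : ArithmeticFunction ℕ := ArithmeticFunction.zeta ^ r

theorem zetaPow_add (r s : ℕ) : zetaPow (r + s) = zetaPow r * zetaPow s := pow_add _ _ _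

theorem zetaPow_succ_apply (r n : ℕ) : zetaPow (r + 1) n = ∑ d ∈ n.divisors, zetaPow r d := by
  rw [zetaPow, pow_succ, ArithmeticFunction.mul_zeta_apply]
  rfl

/-- Sort tuples by the product `d` of all entries but the first; the first entry is then determined
by `d`. Only the upper bound is needed. -/
theorem tau_le_zetaPow (r : ℕ) : ∀ n : ℕ, n ≠ 0 → tau r n ≤ zetaPow r n := by
  induction r with
  | zero =>
    intro n hn
    by_cases h1 : n = 1
    · subst h1
      simp [tau, zetaPow, Nat.finMulAntidiag_one]
    · simp [tau, Nat.finMulAntidiag_zero_left h1]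
  | succ r ih =>
    intro n hn
    rw [zetaPow_succ_apply]
    have hmaps : ∀ f ∈ Nat.finMulAntidiag (r + 1) n, (∏ i, Fin.tail f i) ∈ n.divisors := by
      intro f hf
      rw [Nat.mem_finMulAntidiag, Fin.prod_univ_succ] at hf
      exact Nat.mem_divisors.2 ⟨Dvd.intro_left _ hf.1, hn⟩
    rw [tau, card_eq_sum_card_fiberwise hmaps]
    refine sum_le_sum fun d hd => ?_
    have hd0 : d ≠ 0 := (Nat.pos_of_mem_divisors hd).ne'
    refine le_trans ?_ (ih d hd0)
    refine card_le_card_of_injOn Fin.tail ?_ ?_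
    · intro f hf
      rw [mem_coe, mem_filter] at hf
      rw [mem_coe, Nat.mem_finMulAntidiag]
      exact ⟨hf.2, hd0⟩
    · intro f hf g hg hfg
      rw [mem_coe, mem_filter, Nat.mem_finMulAntidiag, Fin.prod_univ_succ] at hf hg
      have h1 : f 0 * d = g 0 * d := by
        have h2 := hf.1.1
        have h3 := hg.1.1
        have h4 := hf.2
        have h5 := hg.2
        simp only [Fin.tail] at h4 h5
        rw [h4] at h2
        rw [h5] at h3
        rw [h2, h3]
      rw [← Fin.cons_self_tail f, ← Fin.cons_self_tail g, hfg,
        Nat.eq_of_mul_eq_mul_right (Nat.pos_of_ne_zero hd0) h1]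

/-- Every divisor of `mn` is a product of a divisor of `m` and one of `n`; overcounting is harmless.
-/
theorem zetaPow_submultiplicative (s : ℕ) :
    ∀ m n : ℕ, zetaPow s (m * n) ≤ zetaPow s m * zetaPow s n := by
  induction s with
  | zero =>
    intro m n
    by_cases h : m * n = 1
    · obtain rfl := Nat.dvd_one.1 (Dvd.intro _ h)
      obtain rfl := Nat.dvd_one.1 (Dvd.intro_left _ h)
      simp [zetaPow]
    · simp [zetaPow, ArithmeticFunction.one_apply_ne h]
  | succ s ih =>
    intro m n
    rw [zetaPow_succ_apply, zetaPow_succ_apply, zetaPow_succ_apply, sum_mul_sum, ← sum_product',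
      Nat.divisors_mul]
    have h1 : ∀ x ∈ m.divisors ×ˢ n.divisors, zetaPow s (x.1 * x.2) ≤
        zetaPow s x.1 * zetaPow s x.2 := fun x _ => ih _ _
    refine le_trans ?_ (sum_le_sum h1)
    exact sum_image_le_of_nonneg (fun _ _ => Nat.zero_le _)

/-- Induction on `r`: expand `zetaPow (r + 1) n` over `n = ab`, split `zetaPow s (ab)` by
submultiplicativity, and recognise the convolution of `zetaPow (r * s)` with `zetaPow s`. -/
theorem zetaPow_mul_zetaPow_le (r s : ℕ) :
    ∀ n : ℕ, zetaPow r n * zetaPow s n ≤ zetaPow (r * s) n := by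
  induction r with
  | zero =>
    intro n
    by_cases h : n = 1
    · subst h
      rw [Nat.zero_mul]
      have : ∀ s, zetaPow s 1 = 1 := fun s => by
        induction s with
        | zero => simp [zetaPow]
        | succ s ih => rw [zetaPow_succ_apply]; simpa using ih
      simp [this]
    · simp [zetaPow, ArithmeticFunction.one_apply_ne h]
  | succ r ih =>
    intro n
    have h1 : zetaPow (r + 1) n =
        ∑ x ∈ n.divisorsAntidiagonal, zetaPow r x.1 * ArithmeticFunction.zeta x.2 := by
      rw [zetaPow, pow_succ, ArithmeticFunction.mul_apply]
      rfl
    rw [h1, Nat.succ_mul, zetaPow_add, ArithmeticFunction.mul_apply, sum_mul]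
    refine sum_le_sum fun x hx => ?_
    have hx1 := (Nat.mem_divisorsAntidiagonal.1 hx)
    have h0 : x.2 ≠ 0 := fun h => hx1.2 (by rw [← hx1.1, h, mul_zero])
    rw [ArithmeticFunction.zeta_apply_ne h0, mul_one]
    calc zetaPow r x.1 * zetaPow s n ≤ zetaPow r x.1 * (zetaPow s x.1 * zetaPow s x.2) := by
          gcongr
          rw [← hx1.1]
          exact zetaPow_submultiplicative s _ _
      _ = (zetaPow r x.1 * zetaPow s x.1) * zetaPow s x.2 := by ring
      _ ≤ _ := by gcongr; exact ih _

theorem sum_inv_le (x : ℕ) : ∑ m ∈ Ioc 0 x, (1 : ℝ) / m ≤ 1 + Real.log x := by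
  refine le_trans (le_of_eq ?_) (harmonic_le_one_add_log x)
  rw [harmonic_eq_sum_Icc]
  push_cast
  refine sum_congr ?_ fun i _ => by simp
  ext i
  simp [Nat.succ_le_iff]

theorem sum_zetaPow_div_le (r x : ℕ) :
    ∑ m ∈ Ioc 0 x, (zetaPow r m : ℝ) / m ≤ (1 + Real.log x) ^ r := by
  have hlog : 0 ≤ 1 + Real.log x := by
    have := Real.log_natCast_nonneg x
    linarith
  induction r with
  | zero =>
    have h : ∀ m ∈ Ioc 0 x, (zetaPow 0 m : ℝ) / m = if m = 1 then 1 else 0 := by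
      intro m _
      by_cases h : m = 1
      · subst h; simp [zetaPow]
      · simp [zetaPow, ArithmeticFunction.one_apply_ne h, h]
    rw [sum_congr rfl h, sum_ite_eq', pow_zero]
    split_ifs <;> simp
  | succ r ih =>
    have h1 : ∀ m ∈ Ioc 0 x, (zetaPow (r + 1) m : ℝ) / m ≤
        ∑ p ∈ (Ioc 0 x ×ˢ Ioc 0 x).filter (fun p => p.1 * p.2 = m),
          ((zetaPow r p.1 : ℝ) / p.1) * (1 / p.2) := by
      intro m hm
      rw [mem_Ioc] at hm
      rw [zetaPow_succ_apply]
      push_cast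
      rw [sum_div]
      have h2 : ∀ d ∈ m.divisors, (zetaPow r d : ℝ) / m =
          ((zetaPow r (d, m / d).1 : ℝ) / ((d, m / d).1 : ℕ)) * (1 / ((d, m / d).2 : ℕ)) := by
        intro d hd
        have hd1 := Nat.mem_divisors.1 hd
        have hd0 : (d : ℝ) ≠ 0 := by
          have := Nat.pos_of_mem_divisors hd
          positivity
        dsimp only
        rw [Nat.cast_div hd1.1 hd0]
        have hm0 : (m : ℝ) ≠ 0 := by exact_mod_cast hd1.2
        field_simp
      rw [sum_congr rfl h2]
      have hinj : Set.InjOn (fun d => (d, m / d)) (m.divisors : Set ℕ) := fun a _ b _ hab =>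
        (Prod.ext_iff.1 hab).1
      rw [← sum_image (f := fun p : ℕ × ℕ => ((zetaPow r p.1 : ℝ) / p.1) * (1 / p.2)) hinj]
      refine sum_le_sum_of_subset_of_nonneg ?_ fun _ _ _ => by positivity
      intro p hp
      obtain ⟨d, hd, rfl⟩ := mem_image.1 hp
      have hd1 := Nat.mem_divisors.1 hd
      have hd0 := Nat.pos_of_mem_divisors hd
      have hmul := Nat.mul_div_cancel' hd1.1
      simp only [mem_filter, mem_product, mem_Ioc]
      exact ⟨⟨⟨hd0, (Nat.le_of_dvd hm.1 hd1.1).trans hm.2⟩,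
        Nat.div_pos (Nat.le_of_dvd hm.1 hd1.1) hd0, (Nat.div_le_self _ _).trans hm.2⟩, hmul⟩
    calc _ ≤ _ := sum_le_sum h1
      _ ≤ ∑ p ∈ Ioc 0 x ×ˢ Ioc 0 x, ((zetaPow r p.1 : ℝ) / p.1) * (1 / p.2) := by
          refine sum_fiberwise_le_sum_of_sum_fiber_nonneg fun y _ => ?_
          exact sum_nonneg fun _ _ => by positivity
      _ = (∑ m ∈ Ioc 0 x, (zetaPow r m : ℝ) / m) * ∑ m ∈ Ioc 0 x, (1 : ℝ) / m := by
          rw [sum_mul_sum, sum_product]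
      _ ≤ (1 + Real.log x) ^ r * (1 + Real.log x) := by
          gcongr
          exact sum_inv_le x
      _ = _ := (pow_succ _ _).symm

/-- One factor `zeta` is spent on counting multiples, at most `x / m` of them, so only `r`
logarithms appear. -/
theorem sum_zetaPow_le (r x : ℕ) :
    ∑ m ∈ Ioc 0 x, (zetaPow (r + 1) m : ℝ) ≤ x * (1 + Real.log x) ^ r := by
  have h1 : ∑ m ∈ Ioc 0 x, zetaPow (r + 1) m = ∑ m ∈ Ioc 0 x, zetaPow r m * (x / m) := by
    rw [zetaPow, pow_succ, ← zetaPow]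
    exact_mod_cast ArithmeticFunction.sum_Ioc_mul_zeta_eq_sum (zetaPow r) x
  have h2 : ∑ m ∈ Ioc 0 x, (zetaPow (r + 1) m : ℝ) =
      ∑ m ∈ Ioc 0 x, (zetaPow r m : ℝ) * ((x / m : ℕ) : ℝ) := by exact_mod_cast h1
  rw [h2]
  calc _ ≤ ∑ m ∈ Ioc 0 x, x * ((zetaPow r m : ℝ) / m) := by
        refine sum_le_sum fun m _ => ?_
        rw [mul_div_left_comm]
        gcongr
        exact Nat.cast_div_le
    _ = x * ∑ m ∈ Ioc 0 x, (zetaPow r m : ℝ) / m := (mul_sum _ _ _).symm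
    _ ≤ _ := by gcongr; exact sum_zetaPow_div_le r x

/-- The second moment of the five-fold divisor function. -/
theorem sum_tau_sq_le (x : ℕ) :
    ∑ m ∈ Icc 1 x, (tau 5 m : ℝ) ^ 2 ≤ x * (1 + Real.log x) ^ 24 := by
  refine le_trans ?_ (sum_zetaPow_le 24 x)
  have h : Icc 1 x = Ioc 0 x := by
    ext i
    simp [Nat.succ_le_iff]
  rw [h]
  refine sum_le_sum fun m hm => ?_
  have hm0 : m ≠ 0 := (mem_Ioc.1 hm).1.ne'
  have h1 := tau_le_zetaPow 5 m hm0
  have h2 := zetaPow_mul_zetaPow_le 5 5 m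
  have h3 : tau 5 m ^ 2 ≤ zetaPow (24 + 1) m := by
    rw [sq]
    exact (Nat.mul_le_mul h1 h1).trans h2
  exact_mod_cast h3

end Divisor

/-! ### From the bilinear sum to the coefficients -/

section TypeISum

theorem sum_pairs_eq (N : ℕ) (H M : ℝ) (hM : 0 ≤ M) (hH : 0 ≤ H) (f : ℕ × ℕ → ℂ) :
    ∑ p ∈ pairs N H M, f p = ∑ m ∈ (Icc 1 ⌊2 * M⌋₊).filter (fun m : ℕ => M < (m : ℝ)),
      ∑ ℓ ∈ Ioc (N / m) (⌊(N : ℝ) + H⌋₊ / m), f (ℓ, m) := by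
  refine sum_finset_product_right _ _ _ fun p => ?_
  obtain ⟨ℓ, m⟩ := p
  rw [mem_pairs, mem_filter, mem_Icc, mem_Ioc]
  have h0 : M < m → 0 < m := fun h => by
    have : (0 : ℝ) < m := hM.trans_lt h
    exact_mod_cast this
  constructor
  · rintro ⟨⟨h1, h2⟩, h3, h4⟩
    refine ⟨⟨⟨h0 h1, Nat.le_floor h2⟩, h1⟩, ?_, ?_⟩
    · rw [Nat.div_lt_iff_lt_mul (h0 h1)]
      exact_mod_cast h3
    · rw [Nat.le_div_iff_mul_le (h0 h1)]
      exact Nat.le_floor (by exact_mod_cast h4)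
  · rintro ⟨⟨⟨-, h2⟩, h1⟩, h3, h4⟩
    rw [Nat.div_lt_iff_lt_mul (h0 h1)] at h3
    rw [Nat.le_div_iff_mul_le (h0 h1), Nat.le_floor_iff (by positivity)] at h4
    exact ⟨⟨h1, (Nat.le_floor_iff (by positivity)).1 h2⟩, by exact_mod_cast h3,
      by exact_mod_cast h4⟩

/-- Summation by parts against a monotone weight. -/
theorem norm_sum_monotone_mul_le (ψ : ℕ → ℝ) (hψ : Monotone ψ) (hψ0 : 0 ≤ ψ 0) (F : ℕ → ℂ)
    (a b : ℕ) (hab : a ≤ b) (K : ℝ) (hK : 0 ≤ K)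
    (h : ∀ j, a ≤ j → j < b → ‖∑ ℓ ∈ Ioc j b, F ℓ‖ ≤ K) :
    ‖∑ ℓ ∈ Ioc a b, (ψ ℓ : ℂ) * F ℓ‖ ≤ ψ b * K := by
  have key : ∀ r j, a ≤ j → j + r = b →
      ‖∑ ℓ ∈ Ioc j b, (ψ ℓ : ℂ) * F ℓ - ψ j * ∑ ℓ ∈ Ioc j b, F ℓ‖ ≤ (ψ b - ψ j) * K := by
    intro r
    induction r with
    | zero =>
      rintro j - rfl
      simp
    | succ r ih =>
      intro j haj hj
      have h1 := ih (j + 1) (by omega) (by omega)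
      have h2 := h j haj (by omega)
      have hins : ∀ f : ℕ → ℂ, ∑ ℓ ∈ Ioc j b, f ℓ = f (j + 1) + ∑ ℓ ∈ Ioc (j + 1) b, f ℓ := by
        intro f
        rw [← Finset.insert_Ioc_succ_left_eq_Ioc (by omega), sum_insert (by simp)]
        rfl
      have h3 : ∑ ℓ ∈ Ioc j b, (ψ ℓ : ℂ) * F ℓ - ψ j * ∑ ℓ ∈ Ioc j b, F ℓ =
          (∑ ℓ ∈ Ioc (j + 1) b, (ψ ℓ : ℂ) * F ℓ - ψ (j + 1) * ∑ ℓ ∈ Ioc (j + 1) b, F ℓ) +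
            ((ψ (j + 1) - ψ j : ℝ) : ℂ) * ∑ ℓ ∈ Ioc j b, F ℓ := by
        rw [hins fun ℓ => (ψ ℓ : ℂ) * F ℓ, hins F]
        push_cast
        ring
      have h4 : 0 ≤ ψ (j + 1) - ψ j := sub_nonneg.2 (hψ (Nat.le_succ j))
      rw [h3]
      refine (norm_add_le _ _).trans ?_
      rw [norm_mul, Complex.norm_real, Real.norm_eq_abs, abs_of_nonneg h4]
      nlinarith
  have h1 := key (b - a) a le_rfl (by omega)
  have h2 : ‖∑ ℓ ∈ Ioc a b, F ℓ‖ ≤ K := by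
    rcases hab.eq_or_lt with rfl | hlt
    · simpa using hK
    · exact h a le_rfl hlt
  have hψa : 0 ≤ ψ a := hψ0.trans (hψ (Nat.zero_le a))
  have h3 := norm_sub_norm_le (∑ ℓ ∈ Ioc a b, (ψ ℓ : ℂ) * F ℓ) (ψ a * ∑ ℓ ∈ Ioc a b, F ℓ)
  rw [norm_mul, Complex.norm_real, Real.norm_eq_abs, abs_of_nonneg hψa] at h3
  nlinarith

/-- The number of multiples of `m` in an interval of length `H ≥ m`. -/
theorem multiples_le (N m : ℕ) (H : ℝ) (hm : 1 ≤ m) (hmH : (m : ℝ) ≤ H) :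
    ((⌊(N : ℝ) + H⌋₊ / m - N / m : ℕ) : ℝ) ≤ 2 * H / m := by
  have hm0 : (0 : ℝ) < m := by exact_mod_cast hm
  have hH : 0 < H := hm0.trans_le hmH
  rw [Nat.cast_sub (Nat.div_le_div_right (Nat.le_floor (by linarith)))]
  have h1 : ((⌊(N : ℝ) + H⌋₊ / m : ℕ) : ℝ) ≤ (N + H) / m :=
    Nat.cast_div_le.trans (by gcongr; exact Nat.floor_le (by positivity))
  have h2 : (N : ℝ) / m < ((N / m : ℕ) : ℝ) + 1 := by
    rw [div_lt_iff₀ hm0]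
    have := Nat.lt_div_mul_add (a := N) hm
    have h3 : N < (N / m + 1) * m := by linarith
    exact_mod_cast h3
  have h3 : 1 ≤ H / m := by rwa [le_div_iff₀ hm0, one_mul]
  rw [add_div] at h1
  have h4 : 2 * H / m = H / m + H / m := by ring
  linarith

open Classical in
/-- The moduli `m ≤ X` for which some tail of the sum over multiples of `m` is large. -/
noncomputable def goodModuli (N : ℕ) (H B : ℝ) (g : ℕ → ℝ) (X : ℕ) : Finset ℕ :=
  (Icc 1 X).filter fun m => ∃ j, N / m ≤ j ∧ j < ⌊(N : ℝ) + H⌋₊ / m ∧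
    H ≤ B ^ 24 * (m * ‖∑ ℓ ∈ Ioc j (⌊(N : ℝ) + H⌋₊ / m), e (g (ℓ * m))‖)

theorem mem_goodModuli {N : ℕ} {H B : ℝ} {g : ℕ → ℝ} {X m : ℕ} :
    m ∈ goodModuli N H B g X ↔ (1 ≤ m ∧ m ≤ X) ∧ ∃ j, N / m ≤ j ∧ j < ⌊(N : ℝ) + H⌋₊ / m ∧
      H ≤ B ^ 24 * (m * ‖∑ ℓ ∈ Ioc j (⌊(N : ℝ) + H⌋₊ / m), e (g (ℓ * m))‖) := by
  classical
  rw [goodModuli, mem_filter, mem_Icc]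

/-- A large sum over pairs has many good moduli. -/
theorem many_good_moduli (N : ℕ) (H M B : ℝ) (g : ℕ → ℝ) (b : ℕ → ℂ) (ψ : ℕ → ℝ) (hB : 2 ≤ B)
    (hN : 2 ≤ N) (hM : 1 ≤ M) (hMH : 2 * M ≤ H) (hHN : H ≤ N) (hψ : Monotone ψ) (hψ0 : 0 ≤ ψ 0)
    (hψN : ψ ⌊(N : ℝ) + H⌋₊ ≤ 2 * Real.log N)
    (hb : ∀ m : ℕ, 1 ≤ m → ‖b m‖ ≤ (tau 5 m : ℝ))
    (hsum : H * Real.log N ^ 13 ≤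
      B * ‖∑ p ∈ pairs N H M, (ψ p.1 : ℂ) * b p.2 * e (g (p.1 * p.2))‖) :
    (⌊2 * M⌋₊ : ℝ) ≤ B ^ 49 * (goodModuli N H B g ⌊2 * M⌋₊).card := by
  classical
  have hB0 : 0 < B := by linarith
  have hB1 : 1 ≤ B := by linarith
  set X := ⌊2 * M⌋₊ with hX
  have hX2 : (X : ℝ) ≤ 2 * M := Nat.floor_le (by positivity)
  have hX1 : 1 ≤ X := Nat.le_floor (by push_cast; linarith)
  set P := ⌊(N : ℝ) + H⌋₊ with hP
  have hM0 : 0 < M := by linarith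
  have hH0 : 0 < H := by linarith
  set Λ := Real.log N with hΛ
  have hΛ0 : 1 / 2 ≤ Λ := by
    have h1 : Real.log 2 ≤ Λ := Real.log_le_log (by norm_num) (by exact_mod_cast hN)
    have := Real.log_two_gt_d9
    linarith
  have hΛpos : 0 < Λ := by linarith
  set G := goodModuli N H B g X with hG
  set S := (Icc 1 X).filter (fun m : ℕ => M < (m : ℝ)) with hS
  have hNP : N ≤ P := Nat.le_floor (by linarith)
  -- bound for each inner sum
  have hinner : ∀ m ∈ S, ‖∑ ℓ ∈ Ioc (N / m) (P / m), (ψ ℓ : ℂ) * b m * e (g (ℓ * m))‖ ≤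
      tau 5 m * (2 * Λ * (H / M * (1 / B ^ 24 + if m ∈ G then 2 else 0))) := by
    intro m hm
    rw [hS, mem_filter, mem_Icc] at hm
    have hm0 : (0 : ℝ) < m := by exact_mod_cast hm.1.1
    have hmH : (m : ℝ) ≤ H := by
      have : (m : ℝ) ≤ X := by exact_mod_cast hm.1.2
      linarith
    have h1 : ∑ ℓ ∈ Ioc (N / m) (P / m), (ψ ℓ : ℂ) * b m * e (g (ℓ * m)) =
        b m * ∑ ℓ ∈ Ioc (N / m) (P / m), (ψ ℓ : ℂ) * e (g (ℓ * m)) := by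
      rw [mul_sum]
      exact sum_congr rfl fun ℓ _ => by ring
    rw [h1, norm_mul]
    have hK0 : 0 ≤ H / M * (1 / B ^ 24 + if m ∈ G then 2 else 0) := by
      split_ifs <;> positivity
    have h2 : ψ (P / m) ≤ 2 * Λ := (hψ (Nat.div_le_self _ _)).trans hψN
    have hHm : H / m ≤ H / M := by
      gcongr
      exact hm.2.le
    refine mul_le_mul (hb m hm.1.1) ?_ (norm_nonneg _) (Nat.cast_nonneg _)
    refine (norm_sum_monotone_mul_le ψ hψ hψ0 (fun ℓ => e (g (ℓ * m))) _ _
      (Nat.div_le_div_right hNP) _ hK0 ?_).trans (by gcongr)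
    intro j hj1 hj2
    by_cases hmG : m ∈ G
    · rw [if_pos hmG]
      have h3 : ‖∑ ℓ ∈ Ioc j (P / m), e (g (ℓ * m))‖ ≤ ((P / m - N / m : ℕ) : ℝ) := by
        refine (norm_sum_le _ _).trans ((sum_le_card_nsmul _ _ 1 fun n _ => (norm_e _).le).trans ?_)
        rw [Nat.card_Ioc, nsmul_eq_mul, mul_one]
        exact_mod_cast Nat.sub_le_sub_left hj1 _
      refine h3.trans ((multiples_le N m H hm.1.1 hmH).trans ?_)
      calc 2 * H / m = H / m * 2 := by ring
        _ ≤ H / M * 2 := by gcongr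
        _ ≤ H / M * (1 / B ^ 24 + 2) := by
            gcongr
            have : 0 ≤ 1 / B ^ 24 := by positivity
            linarith
    · rw [if_neg hmG, add_zero]
      have h3 : ¬ H ≤ B ^ 24 * (m * ‖∑ ℓ ∈ Ioc j (P / m), e (g (ℓ * m))‖) := fun hcon =>
        hmG (mem_goodModuli.2 ⟨hm.1, j, hj1, hj2, hcon⟩)
      push Not at h3
      calc ‖∑ ℓ ∈ Ioc j (P / m), e (g (ℓ * m))‖ ≤ H / (B ^ 24 * m) := by
            rw [le_div_iff₀ (by positivity)]
            linarith
        _ = H / m * (1 / B ^ 24) := by field_simp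
        _ ≤ _ := by gcongr
  set τ₁ := ∑ m ∈ Icc 1 X, (tau 5 m : ℝ) with hτ₁
  set τ₂ := ∑ m ∈ G, (tau 5 m : ℝ) with hτ₂
  have hGX : G ⊆ Icc 1 X := fun m hm => mem_Icc.2 (mem_goodModuli.1 hm).1
  have hmain : ‖∑ p ∈ pairs N H M, (ψ p.1 : ℂ) * b p.2 * e (g (p.1 * p.2))‖ ≤
      2 * Λ * (H / M * (τ₁ / B ^ 24 + 2 * τ₂)) := by
    rw [sum_pairs_eq N H M hM0.le hH0.le]
    refine (norm_sum_le _ _).trans ((sum_le_sum hinner).trans ?_)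
    have h1 : ∑ m ∈ S, (tau 5 m : ℝ) * (2 * Λ * (H / M * (1 / B ^ 24 + if m ∈ G then 2 else 0))) ≤
        ∑ m ∈ Icc 1 X,
          (tau 5 m : ℝ) * (2 * Λ * (H / M * (1 / B ^ 24 + if m ∈ G then 2 else 0))) := by
      refine sum_le_sum_of_subset_of_nonneg (filter_subset _ _) fun m _ _ => ?_
      split_ifs <;> positivity
    refine h1.trans (le_of_eq ?_)
    have h2 : τ₂ = ∑ m ∈ Icc 1 X, if m ∈ G then (tau 5 m : ℝ) else 0 := by
      rw [sum_ite_mem, inter_eq_right.2 hGX]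
    rw [h2, hτ₁, sum_div, mul_sum, ← sum_add_distrib, mul_sum, mul_sum]
    refine sum_congr rfl fun m _ => ?_
    split_ifs <;> ring
  -- moment bounds
  have hV : ∑ m ∈ Icc 1 X, (tau 5 m : ℝ) ^ 2 ≤ 2 ^ 40 * M * Λ ^ 24 := by
    have hlogX : 1 + Real.log X ≤ 3 * Λ := by
      have h1 : Real.log X ≤ Λ := Real.log_le_log (by exact_mod_cast hX1) (by linarith)
      linarith
    have hlogX0 : 0 ≤ 1 + Real.log X := by
      have := Real.log_natCast_nonneg X
      linarith
    calc _ ≤ X * (1 + Real.log X) ^ 24 := sum_tau_sq_le X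
      _ ≤ (2 * M) * (3 * Λ) ^ 24 := by gcongr
      _ = (2 * 3 ^ 24) * (M * Λ ^ 24) := by ring
      _ ≤ 2 ^ 40 * (M * Λ ^ 24) := by
          gcongr
          norm_num
      _ = _ := by ring
  have hcs : ∀ s : Finset ℕ, s ⊆ Icc 1 X →
      (∑ m ∈ s, (tau 5 m : ℝ)) ^ 2 ≤ s.card * (2 ^ 40 * M * Λ ^ 24) := by
    intro s hs
    refine sq_sum_le_card_mul_sum_sq.trans ?_
    gcongr
    refine le_trans ?_ hV
    exact sum_le_sum_of_subset_of_nonneg hs fun _ _ _ => by positivity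
  have hτ₁b : τ₁ ≤ 2 ^ 21 * M * Λ ^ 12 := by
    refine abs_le_of_sq_le_sq' ?_ (by positivity) |>.2
    refine (hcs _ subset_rfl).trans ?_
    rw [Nat.card_Icc, Nat.add_sub_cancel]
    calc (X : ℝ) * (2 ^ 40 * M * Λ ^ 24) ≤ (2 * M) * (2 ^ 40 * M * Λ ^ 24) := by gcongr
      _ = 2 ^ 41 * (M * Λ ^ 12) ^ 2 := by ring
      _ ≤ 2 ^ 42 * (M * Λ ^ 12) ^ 2 := by gcongr <;> norm_num
      _ = _ := by ring
  -- This fixes the threshold `B ^ 24` in `goodModuli`: terms below it contribute at most half of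
  -- the assumed lower bound.
  have hB24 : 2 ^ 23 * B ≤ B ^ 24 := by
    calc 2 ^ 23 * B ≤ B ^ 23 * B := by gcongr
      _ = B ^ 24 := by ring
  have hτ₂0 : 0 ≤ τ₂ := sum_nonneg fun _ _ => by positivity
  -- comparison
  have hcmp : M * Λ ^ 12 ≤ 8 * B * τ₂ := by
    have h1 : H * Λ ^ 13 ≤ B * (2 * Λ * (H / M * (τ₁ / B ^ 24 + 2 * τ₂))) := by
      refine hsum.trans ?_
      gcongr
    have h2 : B * (2 * Λ * (H / M * (τ₁ / B ^ 24 + 2 * τ₂))) =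
        (H * Λ) * (2 * B * (τ₁ / B ^ 24 + 2 * τ₂) / M) := by ring
    have h3 : H * Λ ^ 13 = (H * Λ) * Λ ^ 12 := by ring
    rw [h2, h3] at h1
    have h4 := le_of_mul_le_mul_left h1 (by positivity)
    rw [le_div_iff₀ hM0] at h4
    have h5 : 2 * B * (τ₁ / B ^ 24) ≤ M * Λ ^ 12 / 2 := by
      rw [← mul_div_assoc, div_le_iff₀ (by positivity)]
      calc 2 * B * τ₁ ≤ 2 * B * (2 ^ 21 * M * Λ ^ 12) := by gcongr
        _ = M * Λ ^ 12 / 2 * (2 ^ 23 * B) := by ring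
        _ ≤ _ := by gcongr
    linarith
  have hfin : M ≤ B ^ 48 * G.card := by
    have h1 : (M * Λ ^ 12) ^ 2 ≤ 64 * B ^ 2 * (G.card * (2 ^ 40 * M * Λ ^ 24)) := by
      calc (M * Λ ^ 12) ^ 2 ≤ (8 * B * τ₂) ^ 2 := by gcongr
        _ = 64 * B ^ 2 * τ₂ ^ 2 := by ring
        _ ≤ _ := by gcongr; exact hcs G hGX
    have h2 : M * (M * Λ ^ 24) ≤ (2 ^ 46 * B ^ 2 * G.card) * (M * Λ ^ 24) := by
      calc M * (M * Λ ^ 24) = (M * Λ ^ 12) ^ 2 := by ring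
        _ ≤ _ := h1
        _ = _ := by ring
    refine (le_of_mul_le_mul_right h2 (by positivity)).trans ?_
    calc 2 ^ 46 * B ^ 2 * (G.card : ℝ) ≤ B ^ 46 * B ^ 2 * G.card := by gcongr
      _ = _ := by ring
  calc (X : ℝ) ≤ 2 * M := hX2
    _ ≤ B * (B ^ 48 * G.card) := by gcongr
    _ = _ := by ring

/-- The polynomial, restricted to the multiples of `m` beyond `N + r`. -/
theorem poly_eq_phase (k N : ℕ) (α : ℕ → ℝ) (hα : α 0 = 0) (m r j i : ℕ) (h : (j + 1) * m = N + r) :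
    poly k N α (((j + 1 + i) * m : ℕ) : ℝ) = phase (k + 1) (shiftCoeff (k + 1) m r α) i := by
  rw [← phase_comp]
  have h1 : (((j + 1 + i) * m : ℕ) : ℝ) - N = m * i + r := by
    have h2 : (((j + 1) * m : ℕ) : ℝ) = ((N + r : ℕ) : ℝ) := by rw [h]
    push_cast at h2 ⊢
    linear_combination h2
  unfold poly phase
  rw [h1, range_eq_Ico, sum_eq_sum_Ico_succ_bot (Nat.succ_pos k), hα, zero_mul, zero_add]
  rfl

/-- The Diophantine information obtained from a good modulus. -/
theorem good_modulus_coefficients (k : ℕ) : ∃ W : ℕ, ∀ (N : ℕ) (H B : ℝ) (α : ℕ → ℝ) (X m : ℕ),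
    2 ≤ B → α 0 = 0 → (X : ℝ) ≤ H →
    m ∈ goodModuli N H B (fun n => poly k N α n) X →
    ∃ q r : ℕ, 1 ≤ q ∧ (q : ℝ) ≤ B ^ W ∧ (r : ℝ) ≤ H ∧ ∀ i ∈ Ico 1 (k + 1),
      H ^ i * distInt (q * shiftCoeff (k + 1) m r α i) ≤ B ^ (W + 24 * k) * (m : ℝ) ^ i := by
  obtain ⟨W, hW⟩ := weyl_inverse k
  refine ⟨25 * W, fun N H B α X m hB hα hXH hm => ?_⟩
  have hB0 : 0 < B := by linarith
  have hB1 : 1 ≤ B := by linarith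
  obtain ⟨hm1, j, hj1, hj2, hj3⟩ := mem_goodModuli.1 hm
  have hm0 : (0 : ℝ) < m := by exact_mod_cast hm1.1
  have hmH : (m : ℝ) ≤ H := (Nat.cast_le.2 hm1.2).trans hXH
  have hH0 : 0 < H := hm0.trans_le hmH
  set P := ⌊(N : ℝ) + H⌋₊ with hP
  have hr1 : N < (j + 1) * m := by
    rw [← Nat.div_lt_iff_lt_mul hm1.1]
    omega
  have hr2 : (j + 1) * m ≤ P := by
    rw [← Nat.le_div_iff_mul_le hm1.1]
    omega
  -- The first multiple of `m` in the tail is `N + r`; the freedom in the starting point `j` is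
  -- absorbed into `r`.
  obtain ⟨r, hr⟩ := Nat.exists_eq_add_of_le hr1.le
  have hrH : (r : ℝ) ≤ H := by
    have h1 : (((j + 1) * m : ℕ) : ℝ) ≤ N + H :=
      (Nat.cast_le.2 hr2).trans (Nat.floor_le (by positivity))
    rw [hr] at h1
    push_cast at h1
    linarith
  set L := P / m - j with hL
  have htail : ∑ ℓ ∈ Ioc j (P / m), e (poly k N α ((ℓ * m : ℕ) : ℝ)) =
      ∑ i ∈ range L, e (phase (k + 1) (shiftCoeff (k + 1) m r α) i) := by
    have h1 : Ioc j (P / m) = Ico (j + 1) (P / m + 1) := by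
      ext x
      simp only [mem_Ioc, mem_Ico]
      omega
    rw [h1, sum_Ico_eq_sum_range]
    refine sum_congr (by congr 1; omega) fun i _ => ?_
    rw [poly_eq_phase k N α hα m r j i hr]
  rw [htail] at hj3
  set s := ‖∑ i ∈ range L, e (phase (k + 1) (shiftCoeff (k + 1) m r α) i)‖ with hs
  have hsL : s ≤ L :=
    (norm_sum_le _ _).trans ((sum_le_card_nsmul _ _ 1 fun n _ => (norm_e _).le).trans (by simp))
  have hLs : (L : ℝ) ≤ B ^ 25 * s := by
    have h1 : (L : ℝ) ≤ 2 * H / m := by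
      refine le_trans ?_ (multiples_le N m H hm1.1 hmH)
      exact_mod_cast Nat.sub_le_sub_left hj1 _
    rw [le_div_iff₀ hm0] at h1
    refine le_of_mul_le_mul_right ?_ hm0
    calc (L : ℝ) * m ≤ 2 * H := h1
      _ ≤ B * (B ^ 24 * (m * s)) := by gcongr
      _ = _ := by ring
  obtain ⟨q, hq1, hq2, hq3⟩ := hW (B ^ 25) L _ (by
    calc (2 : ℝ) ≤ B ^ 1 := by simpa using hB
      _ ≤ B ^ 25 := pow_le_pow_right₀ hB1 (by norm_num)) hLs
  rw [← pow_mul] at hq2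
  refine ⟨q, r, hq1, hq2, hrH, fun i hi => ?_⟩
  have hq3 := hq3 i hi
  rw [← pow_mul] at hq3
  rw [mem_Ico] at hi
  have hd := distInt_nonneg (q * shiftCoeff (k + 1) m r α i)
  -- A large tail is long: `H ≤ B^24 m L`, which converts the precision `L^(-i)` from Weyl into
  -- `(m/H)^i`.
  calc _ ≤ (B ^ 24 * (m * L)) ^ i * distInt (q * shiftCoeff (k + 1) m r α i) := by
        gcongr
        exact hj3.trans (by gcongr)
    _ = B ^ (24 * i) * m ^ i * (L ^ i * distInt (q * shiftCoeff (k + 1) m r α i)) := by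
        rw [mul_pow, mul_pow, ← pow_mul]; ring
    _ ≤ B ^ (24 * k) * m ^ i * B ^ (25 * W) := by
        gcongr
        omega
    _ = _ := by ring

/-- If there are many good moduli then the coefficients of the polynomial are simultaneously well
approximated. -/
theorem approx_of_many_good_moduli (k : ℕ) : ∃ D : ℕ, ∀ (N : ℕ) (H B : ℝ) (α : ℕ → ℝ) (X : ℕ),
    2 ≤ B → α 0 = 0 → 1 ≤ X → B ^ D * X ≤ H →
    (X : ℝ) ≤ B ^ 49 * (goodModuli N H B (fun n => poly k N α n) X).card →
    ∃ q : ℕ, 1 ≤ q ∧ (q : ℝ) ≤ B ^ D ∧ ∀ i ∈ Ico 1 (k + 1), H ^ i * distInt (q * α i) ≤ B ^ D := by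
  obtain ⟨W, hW⟩ := good_modulus_coefficients k
  obtain ⟨D, hD⟩ := triangular_recurrence (fun i => i) (W + 24 * k + 49) (k + 1) k 1 (by omega)
  refine ⟨D, fun N H B α X hB hα hX hXH hcard => ?_⟩
  have hB0 : 0 < B := by linarith
  have hB1 : 1 ≤ B := by linarith
  have hX1 : (1 : ℝ) ≤ X := by exact_mod_cast hX
  have hXH' : (X : ℝ) ≤ H :=
    le_trans (le_mul_of_one_le_left (by positivity) (one_le_pow₀ hB1)) hXH
  have hH0 : 0 < H := by linarith
  set G := goodModuli N H B (fun n => poly k N α n) X with hG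
  have key : ∀ m ∈ G, _ := fun m hm => hW N H B α X m hB hα hXH' hm
  choose! Q R hQ1 hQ2 hR hQ3 using key
  obtain ⟨q, hq1, hq2, hq3⟩ := exists_large_fiber G Q (B ^ W) (one_le_pow₀ hB1)
    (fun m hm => ⟨hQ1 m hm, hQ2 m hm⟩)
  have hGX : ∀ m ∈ G, 1 ≤ m ∧ m ≤ X := fun m hm => (mem_goodModuli.1 hm).1
  refine hD B X (G.filter fun m => Q m = q) α (fun _ => q)
    (fun i j m => q * j.choose i * m ^ i * R m ^ (j - i)) (fun i => H ^ i) hB hX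
    (fun m hm => mem_Icc.2 (hGX m (mem_filter.1 hm).1)) ?_ ?_ (fun i _ => by positivity) ?_ ?_ ?_
  · calc (X : ℝ) ≤ B ^ 49 * G.card := hcard
      _ ≤ B ^ 49 * (B ^ W * (G.filter fun m => Q m = q).card) := by gcongr
      _ = B ^ (W + 49) * (G.filter fun m => Q m = q).card := by ring
      _ ≤ _ := by
          gcongr ?_ * _
          exact pow_le_pow_right₀ hB1 (by omega)
  · exact fun i _ => ⟨hq1, hq2.trans (pow_le_pow_right₀ hB1 (by omega))⟩
  -- The only use of `X` being smaller than `H` by a power of `B`; `i ≥ 1` makes one such power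
  -- enough in every degree.
  · intro i hi
    rw [mem_Ico] at hi
    calc B ^ D * (X : ℝ) ^ i ≤ (B ^ D) ^ i * (X : ℝ) ^ i := by
          gcongr
          exact le_self_pow₀ (one_le_pow₀ hB1) (by omega)
      _ = (B ^ D * X) ^ i := (mul_pow _ _ _).symm
      _ ≤ H ^ i := by gcongr
  · intro i hi m hm
    rw [mem_filter] at hm
    have h1 := hQ3 m hm.1 i hi
    rw [hm.2] at h1
    rw [mem_Ico] at hi
    have h2 : (q : ℝ) * ((m : ℝ) ^ i * α i) + ∑ j ∈ Ico (i + 1) (k + 1),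
        ((q * j.choose i * m ^ i * R m ^ (j - i) : ℤ) : ℝ) * α j =
          q * shiftCoeff (k + 1) m (R m) α i := by
      unfold shiftCoeff
      rw [sum_eq_sum_Ico_succ_bot hi.2, mul_add (q : ℝ), mul_sum]
      congr 1
      · simp
      · refine sum_congr rfl fun j _ => ?_
        push_cast
        ring
    rw [h2]
    refine h1.trans ?_
    gcongr ?_ * ?_
    · exact pow_le_pow_right₀ hB1 (by omega)
    · have := (hGX m hm.1).2
      gcongr
  · intro i hi j hj m hm
    rw [mem_filter] at hm
    rw [mem_Ico] at hi hj
    have hRm := hR m hm.1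
    have hmX : (m : ℝ) ≤ X := by exact_mod_cast (hGX m hm.1).2
    push_cast
    rw [abs_of_nonneg (by positivity)]
    have h1 : ((j.choose i : ℕ) : ℝ) ≤ B ^ k := by
      calc ((j.choose i : ℕ) : ℝ) ≤ ((2 ^ j : ℕ) : ℝ) := by
            exact_mod_cast Nat.choose_le_two_pow _ _
        _ = 2 ^ j := by push_cast; rfl
        _ ≤ B ^ j := by gcongr
        _ ≤ B ^ k := pow_le_pow_right₀ hB1 (by omega)
    calc (q : ℝ) * (j.choose i : ℕ) * (m : ℝ) ^ i * (R m : ℝ) ^ (j - i) * H ^ i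
        ≤ B ^ W * B ^ k * (X : ℝ) ^ i * H ^ (j - i) * H ^ i := by gcongr
      _ = B ^ (W + k) * (X : ℝ) ^ i * H ^ (j - i + i) := by rw [pow_add, pow_add]; ring
      _ = B ^ (W + k) * (X : ℝ) ^ i * H ^ j := by
          rw [Nat.sub_add_cancel (by omega)]
      _ ≤ _ := by
          gcongr ?_ * _ * _
          exact pow_le_pow_right₀ hB1 (by omega)

end TypeISum

end TypeI

/-! ### Conclusion, with `B = δ⁻¹` -/

theorem proposition2p1 (k : ℕ) (hk : 1 ≤ k) :
    ∃ C A : ℝ, 0 < C ∧ 0 < A ∧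
      ∀ (N : ℕ) (θ H δ M : ℝ) (α : ℕ → ℝ) (b : ℕ → ℂ) (ψ : ℕ → ℝ),
        2 ≤ N → 0 < θ → θ ≤ 1 → H = (N : ℝ) ^ θ →
        0 < δ → δ < 1 / 2 →
        1 ≤ M → M ≤ δ ^ C * H →
        (∀ m : ℕ, 1 ≤ m → ‖b m‖ ≤ (TypeI.tau 5 m : ℝ)) →
        (ψ = (fun _ : ℕ => (1 : ℝ)) ∨ ψ = (fun ℓ : ℕ => Real.log ℓ)) →
        δ * H * Real.log N ^ 13 ≤
          ‖∑ p ∈ TypeI.pairs N H M,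
              (ψ p.1 : ℂ) * b p.2 * TypeI.e (TypeI.poly k N α ((p.1 * p.2 : ℕ) : ℝ))‖ →
        ∃ q : ℕ, 1 ≤ q ∧ (q : ℝ) ≤ δ ^ (-A) ∧
          ∀ j : ℕ, 1 ≤ j → j ≤ k →
            TypeI.distInt (q * α j) ≤ δ ^ (-A) * (1 / H ^ j) := by
  obtain ⟨D, hD⟩ := TypeI.approx_of_many_good_moduli k
  -- The extra power in `C` absorbs the factor 2 in `X ≤ 2M`; in `A` it ensures positivity.
  refine ⟨(D + 1 : ℕ), (D + 1 : ℕ), by positivity, by positivity, ?_⟩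
  intro N θ H δ M α b ψ hN _ hθ1 hH hδ0 hδ hM hMH hb hψ hsum
  set B := δ⁻¹ with hB
  have hδB : δ = B⁻¹ := (inv_inv δ).symm
  have hB2 : 2 ≤ B := by
    rw [hB, le_inv_comm₀ (by norm_num) hδ0]
    linarith
  have hB0 : 0 < B := by linarith
  have hB1 : 1 ≤ B := by linarith
  have hN1 : (2 : ℝ) ≤ N := by exact_mod_cast hN
  have hH0 : 0 < H := by rw [hH]; positivity
  have hHN : H ≤ N := by
    rw [hH]
    calc (N : ℝ) ^ θ ≤ (N : ℝ) ^ (1 : ℝ) := Real.rpow_le_rpow_of_exponent_le (by linarith) hθ1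
      _ = N := Real.rpow_one _
  rw [Real.rpow_natCast, hδB, inv_pow, inv_mul_eq_div, le_div_iff₀ (by positivity)] at hMH
  have hMH2 : B ^ D * (2 * M) ≤ H := by
    calc B ^ D * (2 * M) ≤ B ^ D * (B * M) := by gcongr
      _ = M * B ^ (D + 1) := by ring
      _ ≤ H := hMH
  have h2MH : 2 * M ≤ H :=
    le_trans (le_mul_of_one_le_left (by positivity) (one_le_pow₀ hB1)) hMH2
  have hlogN : Real.log 2 ≤ Real.log N := Real.log_le_log (by norm_num) hN1
  have hlog2 := Real.log_two_gt_d9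
  have hψ' : Monotone ψ ∧ 0 ≤ ψ 0 ∧ ψ ⌊(N : ℝ) + H⌋₊ ≤ 2 * Real.log N := by
    rcases hψ with rfl | rfl
    · exact ⟨monotone_const, zero_le_one, by linarith⟩
    -- The convention `Real.log 0 = 0` makes the logarithm monotone on all of `ℕ`.
    · refine ⟨fun x y hxy => ?_, by simp, ?_⟩
      · rcases Nat.eq_zero_or_pos x with rfl | hx
        · simpa using Real.log_natCast_nonneg y
        · exact Real.log_le_log (by exact_mod_cast hx) (by exact_mod_cast hxy)
      · have h1 : (⌊(N : ℝ) + H⌋₊ : ℝ) ≤ 2 * N :=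
          (Nat.floor_le (by positivity)).trans (by linarith)
        have h2 : (0 : ℝ) < ⌊(N : ℝ) + H⌋₊ := by
          exact_mod_cast Nat.floor_pos.2 (by linarith)
        calc Real.log ⌊(N : ℝ) + H⌋₊ ≤ Real.log (2 * N) := Real.log_le_log h2 h1
          _ = Real.log 2 + Real.log N := Real.log_mul (by norm_num) (by positivity)
          _ ≤ _ := by linarith
  obtain ⟨hψm, hψ0, hψN⟩ := hψ'
  -- `poly` starts in degree 1 and `phase` in degree 0, so the irrelevant value `α 0` is set to
  -- zero.
  set α' : ℕ → ℝ := fun j => if j = 0 then 0 else α j with hα'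
  have hpoly : ∀ x, TypeI.poly k N α' x = TypeI.poly k N α x := by
    intro x
    refine Finset.sum_congr rfl fun j hj => ?_
    have : j ≠ 0 := by
      have := (Finset.mem_Icc.1 hj).1
      omega
    simp [hα', this]
  have hcard := TypeI.many_good_moduli N H M B (fun n => TypeI.poly k N α' n) b ψ hB2 hN hM h2MH
    hHN hψm hψ0 hψN hb (by
      simp_rw [hpoly]
      have h1 := mul_le_mul_of_nonneg_left hsum hB0.le
      refine le_trans (le_of_eq ?_) h1
      rw [hδB]
      field_simp)
  obtain ⟨q, hq1, hq2, hq3⟩ := hD N H B α' ⌊2 * M⌋₊ hB2 (by simp [hα'])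
    (Nat.le_floor (by push_cast; linarith)) (by
      refine le_trans ?_ hMH2
      gcongr
      exact Nat.floor_le (by positivity)) hcard
  have hpow : δ ^ (-((D + 1 : ℕ) : ℝ)) = B ^ (D + 1) := by
    rw [Real.rpow_neg hδ0.le, Real.rpow_natCast, hB, inv_pow]
  have hBD : B ^ D ≤ B ^ (D + 1) := pow_le_pow_right₀ hB1 (by omega)
  rw [hpow]
  refine ⟨q, hq1, hq2.trans hBD, fun j hj1 hj2 => ?_⟩
  have h1 := hq3 j (Finset.mem_Ico.2 ⟨hj1, by omega⟩)
  have h2 : α' j = α j := by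
    have : j ≠ 0 := by omega
    simp [hα', this]
  rw [h2] at h1
  rw [mul_one_div, le_div_iff₀ (by positivity), mul_comm]
  exact h1.trans hBD
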